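/- **Setting.** Let $m\ge 1$, $d_1,\dots,d_m\ge 1$ and $d=d_1+\dots+d_m$, and write $x=(x_1,\dots,x_m)\in\mathbb R^{d_1}\times\dots\times\mathbb R^{d_m}=\mathbb R^d$. For $j=1,\dots,m$ let $\tilde E_j\in\mathbb R^{d_j\times d_j}$ be a matrix all of whose eigenvalues have positive real part, let $a_1^j>0$ be the smallest of these real parts, and let $q_j=\operatorname{trace}(\tilde E_j)$. For $c>0$ put $c^{A}=\exp((\log c)A)$. Let $\psi_j:\mathbb R^{d_j}\to[0,\infty)$ be continuous with $\psi_j(\xi)\ne0$ for $\xi\neq 0$ and $\psi_j(c^{\tilde E_j^T}\xi)=c\,\psi_j(\xi)$ for all $c>0$ and $\xi\in\mathbb R^{d_j}$. Let $0<\alpha\le 2$ and $H_j\in(0,a_1^j)$ for all $j$. Let $W_\alpha$ be a complex isotropic symmetric $\alpha$-stable random measure on $\mathbb R^d$ with Lebesgue control measure, normalised by $\mathbb E\,e^{i\operatorname{Re}(\bar z W_\alpha(A))}=e^{-\kappa|A|\,|z|^\alpha}$ for $z\in\mathbb C$ and Borel sets $A$ of finite Lebesgue measure $|A|$, where $\kappa>0$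 is a fixed constant, and let $X_\alpha$ be (any version of) the random field $$X_\alpha(x)=\operatorname{Re}\int_{\mathbb R^d}\prod_{j=1}^m\bigl(e^{i\langle x_j,\xi_j\rangle}-1\bigr)\,\psi_j(\xi_j)^{-H_j-q_j/\alpha}\,W_\alpha(d\xi),\qquad x\in\mathbb R^d .$$ Let $\tau_{\tilde E_1}$ be a radial part with respect to $\tilde E_1$, that is, a continuous function $\tau_{\tilde E_1}:\mathbb R^{d_1}\to[0,\infty)$ with $\tau_{\tilde E_1}(0)=0$ such that every $u\neq0$ can be written uniquely as $u=r^{\tilde E_1}l$ with $r>0$ and $\tau_{\tilde E_1}(l)=1$, and then $r=\tau_{\tilde E_1}(u)$. **Theorem.** There is a constant $C_4>0$, depending only on $m$, the $d_j$, $\tilde E_j$, $\psi_j$, $H_j$, on $\alpha$, $\kappa$ and $\tau_{\tilde E_1}$ (and not on $x$, $y$, nor on the probability space or on the choice of $W_\alpha$ and $X_\alpha$), such that for all $x,y\in[\tfrac12,1)^{d_1}\times\dots\times[\tfrac12,1)^{d_m}$ the random variable $X_\alpha(x)-X_\alpha(y)$ is symmetric $\alpha$-stable and its scale parameter $\sigma(x,y)=\|X_\alpha(x)-X_\alpha(y)\|_\alpha\ge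 0$, determined by $\mathbb E\,e^{it(X_\alpha(x)-X_\alpha(y))}=e^{-\sigma(x,y)^\alpha|t|^\alpha}$ for $t\in\mathbb R$, satisfies $$\sigma(x,y)\ \ge\ C_4\,\tau_{\tilde E_1}(x_1-y_1)^{H_1}.$$ The same lower bound, with the same constant, holds for the (possibly infinite) moment $\bigl(\mathbb E|X_\alpha(x)-X_\alpha(y)|^\alpha\bigr)^{1/\alpha}$. -/

import Mathlib

open MeasureTheory ProbabilityTheory Filter Topology
open scoped Matrix

noncomputable section

namespace StableSheet

/-- The matrix power `c^A = exp((log c) A)`, acting on a vector of `ℝ^n`. -/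
def powAct {n : ℕ} (c : ℝ) (A : Matrix (Fin n) (Fin n) ℝ) (x : EuclideanSpace ℝ (Fin n)) :
    EuclideanSpace ℝ (Fin n) :=
  WithLp.toLp 2 (NormedSpace.exp (Real.log c • A) *ᵥ x.ofLp)

/-- The complex eigenvalues of a real square matrix. -/
def eigenvals {n : ℕ} (A : Matrix (Fin n) (Fin n) ℝ) : Set ℂ :=
  spectrum ℂ (A.map (algebraMap ℝ ℂ))

/-- `φ` is `A`-homogeneous: `φ(c^A x) = c φ(x)` for all `c > 0`. -/
def IsHomogeneous {n : ℕ} (A : Matrix (Fin n) (Fin n) ℝ) (φ : EuclideanSpace ℝ (Fin n) → ℝ) :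
    Prop :=
  ∀ c : ℝ, 0 < c → ∀ x, φ (powAct c A x) = c * φ x

/-- `τ` is the radial part of a system of polar coordinates with respect to `A`: every `x ≠ 0` is
uniquely of the form `x = r^A l` with `r > 0` and `l` in the unit sphere `{τ = 1}`, the radius
being `r = τ x`; and `τ` is continuous on the whole space, with `τ 0 = 0`. (The polar coordinates
depend on the choice of the unit sphere; this covers every choice.) -/
structure IsRadialPart {n : ℕ} (A : Matrix (Fin n) (Fin n) ℝ)
    (τ : EuclideanSpace ℝ (Fin n) → ℝ) : Prop where
  continuous : Continuous τ
  zero : τ 0 = 0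
  pos : ∀ x, x ≠ 0 → 0 < τ x
  polar : ∀ x, x ≠ 0 → ∃ l, τ l = 1 ∧ x = powAct (τ x) A l
  unique : ∀ x, x ≠ 0 → ∀ r l r' l', 0 < r → τ l = 1 → x = powAct r A l →
    0 < r' → τ l' = 1 → x = powAct r' A l' → r = r' ∧ l = l'

/-- The product `ℝ^{d_1} × ⋯ × ℝ^{d_m}`; its `volume` is Lebesgue measure. -/
abbrev Space {m : ℕ} (d : Fin m → ℕ) : Type :=
  (j : Fin m) → EuclideanSpace ℝ (Fin (d j))

variable {S Ω : Type*} [MeasureSpace S] [MeasurableSpace Ω]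

/-- `W` is a complex isotropic symmetric `α`-stable random measure on `S` with control measure
`volume`: it is defined on the measurable sets of finite measure, is independently scattered and
almost surely countably additive, and `E exp(i Re(z̄ W(A))) = exp(-κ |A| |z|^α)`. The constant
`κ > 0` is the normalisation of the control measure, for which several conventions are in use. -/
structure IsIsotropicStableMeasure (α κ : ℝ) (P : Measure Ω) (W : Set S → Ω → ℂ) : Prop where
  aemeasurable : ∀ A, MeasurableSet A → volume A < ⊤ → AEMeasurable (W A) P
  charFun_eq : ∀ A, MeasurableSet A → volume A < ⊤ → ∀ z : ℂ,
    charFun (P.map (W A)) z = Complex.exp (-(κ * volume.real A * ‖z‖ ^ α : ℝ))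
  indep : ∀ (n : ℕ) (A : Fin n → Set S), (∀ i, MeasurableSet (A i)) →
    (∀ i, volume (A i) < ⊤) → Pairwise (Function.onFun Disjoint A) →
    iIndepFun (fun i => W (A i)) P
  sigmaAdditive : ∀ A : ℕ → Set S, (∀ i, MeasurableSet (A i)) →
    Pairwise (Function.onFun Disjoint A) → volume (⋃ i, A i) < ⊤ →
    ∀ᵐ ω ∂P, Tendsto (fun n => ∑ i ∈ Finset.range n, W (A i) ω) atTop (𝓝 (W (⋃ i, A i) ω))

/-- The stochastic integral `∫ g dW = ∑ c W(g = c)` of a simple function. The value `0`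
contributes nothing, so only sets of finite measure matter when `g` has support of finite
measure. -/
def simpleIntegral (W : Set S → Ω → ℂ) (g : SimpleFunc S ℂ) (ω : Ω) : ℂ :=
  ∑ c ∈ g.range, c * W (g ⁻¹' {c}) ω

/-- `Z` is (a version of) the stable integral `∫ f dW`: the limit in probability of the integrals of
simple functions that converge to `f` in `L^α`. -/
def IsStableIntegral (α : ℝ) (P : Measure Ω) (W : Set S → Ω → ℂ) (f : S → ℂ) (Z : Ω → ℂ) : Prop :=
  AEMeasurable f volume ∧
  ∃ g : ℕ → SimpleFunc S ℂ,
    (∀ n, (g n).FinMeasSupp volume) ∧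
    Tendsto (fun n => ∫⁻ ξ, ‖g n ξ - f ξ‖ₑ ^ α) atTop (𝓝 0) ∧
    TendstoInMeasure P (fun n => simpleIntegral W (g n)) atTop Z

/-- The harmonizable kernel
`ξ ↦ ∏_j (exp(i⟨x_j, ξ_j⟩) - 1) ψ_j(ξ_j)^(-H_j - q_j/α)`, where `q_j = trace E_j`. -/
def kernel {m : ℕ} {d : Fin m → ℕ} (α : ℝ) (E : ∀ j, Matrix (Fin (d j)) (Fin (d j)) ℝ)
    (ψ : ∀ j, EuclideanSpace ℝ (Fin (d j)) → ℝ) (H : Fin m → ℝ) (x ξ : Space d) : ℂ :=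
  ∏ j, (Complex.exp (Complex.I * (inner ℝ (x j) (ξ j) : ℝ)) - 1) *
    ((ψ j (ξ j) ^ (-H j - (E j).trace / α) : ℝ) : ℂ)

/-- `X` is (a version of) the harmonizable operator scaling stable random sheet
`X(x) = Re ∫ kernel(x, ξ) W(dξ)`. -/
def IsHarmonizableSheet {m : ℕ} {d : Fin m → ℕ} (α : ℝ)
    (E : ∀ j, Matrix (Fin (d j)) (Fin (d j)) ℝ) (ψ : ∀ j, EuclideanSpace ℝ (Fin (d j)) → ℝ)
    (H : Fin m → ℝ) (P : Measure Ω) (W : Set (Space d) → Ω → ℂ) (X : Space d → Ω → ℝ) : Prop :=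
  ∀ x, ∃ Z : Ω → ℂ, IsStableIntegral α P W (kernel α E ψ H x) Z ∧
    X x =ᵐ[P] fun ω => (Z ω).re

/-- `Z` is a real symmetric `α`-stable random variable with scale parameter `‖Z‖_α = s`, that is,
`E exp(itZ) = exp(-s^α |t|^α)`. This determines `s ≥ 0`. -/
def HasStableScale (α : ℝ) (P : Measure Ω) (Z : Ω → ℝ) (s : ℝ) : Prop :=
  AEMeasurable Z P ∧ 0 ≤ s ∧
    ∀ t : ℝ, charFun (P.map Z) t = Complex.exp (-(s ^ α * |t| ^ α : ℝ))

end StableSheet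

end

/-! The increment is the real part of the stable integral of the kernel difference, so `σ(x,y)^α`
equals `κ` times the `L^α` integral of that difference (`IsHarmonizableSheet.hasStableScale`). Its
finiteness comes for free from the existence of the stable integrals, so only a deterministic lower
bound on this integral is needed.

Restrict the frequencies of all blocks but the first to boxes where their factors stay away from
zero. With these frequencies frozen, the difference is a common weight times `z (e^{i⟨x₁,ξ⟩} - 1) -
w (e^{i⟨y₁,ξ⟩} - 1)` times a power of `ψ₁(ξ)`, where `z` and `w` come from the other blocks of `x`
and `y` and are in general different. Substitute `ξ = g^{-Eᵀ} η` with `g = ε τ(x₁ - y₁)`. The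
frequencies become `g^{-E} x₁` and `g^{-E} y₁`, and for small `ε` these two and `0` are pairwise as
far apart as desired (`IsRadialPart.exists_le_norm_powAct`). By Riemann–Lebesgue the three
exponentials are almost orthogonal on the unit ball (`exists_le_integral_norm_sq_exponential_sum`),
so `w` cannot cancel the contribution of `|z|²`. Since `α ≤ 2` and the sum is bounded, the `L²`
bound gives an `L^α` bound. Homogeneity of `ψ₁` together with the Jacobian leaves exactly `g^{αH₁}`
(`exists_le_lintegral_first_factor`).

The moment bound follows by evaluating the characteristic function at `1/σ`
(`HasStableScale.le_lintegral`). -/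

noncomputable section

namespace StableSheet

/-! ### Determinant of the matrix exponential -/

section
open scoped Matrix.Norms.Operator
theorem hasDerivAt_exp_smul_matrix {n : ℕ} (A : Matrix (Fin n) (Fin n) ℝ) (t : ℝ) :
    HasDerivAt (fun s : ℝ => NormedSpace.exp (s • A)) (NormedSpace.exp (t • A) * A) t :=
  hasDerivAt_exp_smul_const (𝕂 := ℝ) A t

theorem hasDerivAt_exp_smul_apply {n : ℕ} (A : Matrix (Fin n) (Fin n) ℝ) (t : ℝ) (i j : Fin n) :
    HasDerivAt (fun s : ℝ => NormedSpace.exp (s • A) i j) ((NormedSpace.exp (t • A) * A) i j) t := by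
  have h := hasDerivAt_exp_smul_matrix A t
  let L : Matrix (Fin n) (Fin n) ℝ →ₗ[ℝ] ℝ := Matrix.entryLinearMap ℝ ℝ i j
  exact (LinearMap.toContinuousLinearMap L).hasFDerivAt.comp_hasDerivAt t h
end

/-- The derivative depends on `f` only through its value and entrywise derivative at `x`. Hence `det
(exp (tA))` and `det (1 + tA)` have the same derivative at `0`, and the latter is a polynomial whose
linear coefficient is the trace. -/
theorem hasDerivAt_det {n : ℕ} (f : ℝ → Matrix (Fin n) (Fin n) ℝ) (f' : Matrix (Fin n) (Fin n) ℝ)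
    (x : ℝ) (hf : ∀ i j, HasDerivAt (fun t => f t i j) (f' i j) x) :
    HasDerivAt (fun t => (f t).det)
      (∑ σ : Equiv.Perm (Fin n), (Equiv.Perm.sign σ : ℝ) *
        ∑ i, (∏ j ∈ Finset.univ.erase i, f x (σ j) j) • f' (σ i) i) x := by
  simp only [Matrix.det_apply']
  refine HasDerivAt.fun_sum fun σ _ => HasDerivAt.const_mul _ ?_
  exact HasDerivAt.fun_finsetProd fun i _ => hf _ _

theorem hasDerivAt_det_one_add_smul {n : ℕ} (A : Matrix (Fin n) (Fin n) ℝ) :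
    HasDerivAt (fun t : ℝ => (1 + t • A).det) A.trace 0 := by
  rw [funext fun t : ℝ => Matrix.det_one_add_smul t A]
  set p : Polynomial ℝ := Polynomial.divX (Polynomial.divX
    (1 + (Polynomial.X : Polynomial ℝ) • A.map Polynomial.C).det)
  have h1 : HasDerivAt (fun t : ℝ => 1 + A.trace * t + p.eval t * t ^ 2)
      (A.trace * 1 + (p.derivative.eval 0 * 0 ^ 2 + p.eval 0 * ((2 : ℕ) * 0 ^ (2 - 1)))) 0 := by
    refine HasDerivAt.add ?_ ?_
    · exact ((hasDerivAt_id (0:ℝ)).const_mul _).const_add _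
    · exact (Polynomial.hasDerivAt _ _).mul (hasDerivAt_pow 2 (0:ℝ))
  simpa using h1

theorem hasDerivAt_det_exp_smul_zero {n : ℕ} (A : Matrix (Fin n) (Fin n) ℝ) :
    HasDerivAt (fun t : ℝ => (NormedSpace.exp (t • A)).det) A.trace 0 := by
  have h1 := hasDerivAt_det (fun t : ℝ => NormedSpace.exp (t • A)) A 0 (fun i j => by
    simpa using hasDerivAt_exp_smul_apply A 0 i j)
  have h2 := hasDerivAt_det (fun t : ℝ => 1 + t • A) A 0 (fun i j => by
    simpa using ((hasDerivAt_id (0:ℝ)).mul_const (A i j)).const_add ((1 : Matrix (Fin n) (Fin n) ℝ) i j))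
  have h3 := h2.unique (hasDerivAt_det_one_add_smul A)
  simp only [zero_smul, NormedSpace.exp_zero, add_zero] at h1 h3
  rwa [h3] at h1

theorem exp_add_smul_matrix {n : ℕ} (A : Matrix (Fin n) (Fin n) ℝ) (s t : ℝ) :
    NormedSpace.exp ((s + t) • A) = NormedSpace.exp (s • A) * NormedSpace.exp (t • A) := by
  rw [add_smul, Matrix.exp_add_of_commute]
  exact ((Commute.refl A).smul_left s).smul_right t

/-- The one-parameter group law turns the derivative at `0` into the equation `D' = D · trace A`, so
`D(t) e^{-t trace A}` is constant. -/
theorem det_exp_smul {n : ℕ} (A : Matrix (Fin n) (Fin n) ℝ) (t : ℝ) :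
    (NormedSpace.exp (t • A)).det = Real.exp (t * A.trace) := by
  have hd (s : ℝ) : HasDerivAt (fun t : ℝ => (NormedSpace.exp (t • A)).det)
      ((NormedSpace.exp (s • A)).det * A.trace) s := by
    have h0 : HasDerivAt (fun t : ℝ => (NormedSpace.exp (t • A)).det) A.trace (s + -s) := by
      simpa using hasDerivAt_det_exp_smul_zero A
    have h := (h0.comp_add_const s (-s)).const_mul ((NormedSpace.exp (s • A)).det)
    refine h.congr_of_eventuallyEq (Eventually.of_forall fun u => ?_)
    simp only [← Matrix.det_mul, ← exp_add_smul_matrix]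
    congr 3; ring
  have hc (s : ℝ) : HasDerivAt (fun t : ℝ => (NormedSpace.exp (t • A)).det * Real.exp (-(t * A.trace)))
      0 s := by
    convert! (hd s).mul (((hasDerivAt_id s).mul_const A.trace).neg.exp) using 1
    simp only [Pi.neg_apply, id, one_mul]
    ring
  have h := is_const_of_deriv_eq_zero (fun s => (hc s).differentiableAt) (fun s => (hc s).deriv) t 0
  simp only [zero_smul, NormedSpace.exp_zero, Matrix.det_one, zero_mul, neg_zero, Real.exp_zero, mul_one,
    Real.exp_neg] at h
  field_simp at h
  exact h

/-! ### Decay of `exp (-tA)` and positivity of the trace -/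

section
open scoped Matrix.Norms.Operator
theorem hasSum_exp_mulVec {n : ℕ} (A : Matrix (Fin n) (Fin n) ℂ) (v : Fin n → ℂ) :
    HasSum (fun k : ℕ => ((k.factorial : ℂ)⁻¹ • A ^ k) *ᵥ v) (NormedSpace.exp A *ᵥ v) := by
  have h := NormedSpace.exp_series_hasSum_exp' (𝕂 := ℂ) A
  have hc : Continuous (fun M : Matrix (Fin n) (Fin n) ℂ => M *ᵥ v) := by fun_prop
  exact h.map (AddMonoidHom.mk' (fun M : Matrix (Fin n) (Fin n) ℂ => M *ᵥ v)
    (fun M N => Matrix.add_mulVec M N v)) hc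

theorem exp_smul_one_matrix {n : ℕ} (c : ℂ) :
    NormedSpace.exp (c • (1 : Matrix (Fin n) (Fin n) ℂ)) = Complex.exp c • 1 := by
  have h := NormedSpace.algebraMap_exp_comm (𝕂 := ℂ) (𝔸 := Matrix (Fin n) (Fin n) ℂ) c
  rw [Algebra.algebraMap_eq_smul_one, Algebra.algebraMap_eq_smul_one] at h
  rw [Complex.exp_eq_exp_ℂ]
  exact h.symm

theorem map_ofReal_exp {n : ℕ} (A : Matrix (Fin n) (Fin n) ℝ) :
    (NormedSpace.exp A).map (algebraMap ℝ ℂ) = NormedSpace.exp (A.map (algebraMap ℝ ℂ)) := by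
  have hc : Continuous ((algebraMap ℝ ℂ).mapMatrix : Matrix (Fin n) (Fin n) ℝ →+* _) := by
    refine continuous_matrix fun i j => ?_
    exact Complex.continuous_ofReal.comp (continuous_id.matrix_elem i j)
  exact NormedSpace.map_exp (algebraMap ℝ ℂ).mapMatrix hc A
end

/-- Writing `B = μ + N`, the exponential series of `N` stops on `v`, so `exp (-tB) v` is `e^{-tμ}`
times a polynomial in `t`, and `Re μ > 0` wins. Generalised eigenspaces span, which gives the decay
for every vector. -/
theorem tendsto_exp_neg_smul_mulVec_of_mem_genEigenspace {n : ℕ} (B : Matrix (Fin n) (Fin n) ℂ)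
    {μ : ℂ} (hμ : 0 < μ.re) {v : Fin n → ℂ} {k : ℕ} (hv : (B - μ • 1) ^ k *ᵥ v = 0) :
    Tendsto (fun t : ℝ => NormedSpace.exp (-(t : ℂ) • B) *ᵥ v) atTop (𝓝 0) := by
  set N := B - μ • (1 : Matrix (Fin n) (Fin n) ℂ) with hN
  have hpow (j : ℕ) (hj : k ≤ j) : N ^ j *ᵥ v = 0 := by
    obtain ⟨i, rfl⟩ := Nat.exists_eq_add_of_le' hj
    rw [pow_add, ← Matrix.mulVec_mulVec, hv, Matrix.mulVec_zero]
  have key (t : ℝ) : NormedSpace.exp (-(t : ℂ) • B) *ᵥ v =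
      ∑ j ∈ Finset.range k, (Complex.exp (-(t * μ)) * t ^ j) •
        (((-1) ^ j * (j.factorial : ℂ)⁻¹) • (N ^ j *ᵥ v)) := by
    have h1 : -(t : ℂ) • B = (-(t * μ)) • (1 : Matrix (Fin n) (Fin n) ℂ) + (-(t : ℂ)) • N := by
      rw [hN, smul_sub, smul_smul, neg_mul]; abel
    rw [h1, Matrix.exp_add_of_commute _ _ ((Commute.one_left _).smul_left _), exp_smul_one_matrix,
      smul_mul_assoc, one_mul, Matrix.smul_mulVec]
    have h2 := hasSum_exp_mulVec (-(t : ℂ) • N) v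
    rw [← h2.tsum_eq, tsum_eq_sum (s := Finset.range k), Finset.smul_sum]
    · refine Finset.sum_congr rfl fun j _ => ?_
      rw [smul_pow, Matrix.smul_mulVec, Matrix.smul_mulVec, smul_smul, smul_smul, smul_smul]
      congr 1
      rw [neg_pow]; ring
    · intro j hj
      rw [smul_pow, Matrix.smul_mulVec, Matrix.smul_mulVec, hpow j (by simpa using hj), smul_zero, smul_zero]
  simp_rw [key]
  rw [show (0 : Fin n → ℂ) = ∑ j ∈ Finset.range k, (0:ℂ) •
    (((-1) ^ j * (j.factorial : ℂ)⁻¹) • (N ^ j *ᵥ v)) by simp]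
  refine tendsto_finsetSum _ fun j _ => Tendsto.smul_const ?_ _
  rw [tendsto_zero_iff_norm_tendsto_zero]
  have h3 := Real.tendsto_pow_mul_exp_neg_atTop_nhds_zero j
  have h4 := (h3.comp (tendsto_id.const_mul_atTop hμ)).const_mul ((μ.re ^ j)⁻¹)
  rw [mul_zero] at h4
  refine h4.congr' ?_
  filter_upwards [eventually_ge_atTop 0] with t ht
  have : 0 < μ.re ^ j := by positivity
  simp [Complex.norm_exp, abs_of_nonneg ht, mul_pow]
  field_simp

theorem tendsto_exp_neg_smul_mulVec {n : ℕ} (B : Matrix (Fin n) (Fin n) ℂ)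
    (hB : ∀ μ ∈ spectrum ℂ B, 0 < μ.re) (v : Fin n → ℂ) :
    Tendsto (fun t : ℝ => NormedSpace.exp (-(t : ℂ) • B) *ᵥ v) atTop (𝓝 0) := by
  have hv : v ∈ ⨆ μ : ℂ, Module.End.maxGenEigenspace (Matrix.toLin' B) μ := by
    rw [Module.End.iSup_maxGenEigenspace_eq_top]; trivial
  induction hv using Submodule.iSup_induction' with
  | zero => simp
  | add x y _ _ hx hy => simpa [Matrix.mulVec_add] using hx.add hy
  | mem μ x hx =>
    by_cases hx0 : x = 0
    · simp [hx0]
    obtain ⟨k, hk⟩ := (Module.End.mem_maxGenEigenspace _ _ _).1 hx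
    have hμ : μ ∈ spectrum ℂ B := by
      rw [← Matrix.spectrum_toLin']
      refine Module.End.HasEigenvalue.mem_spectrum
        (Module.End.HasUnifEigenvalue.lt (k := ⊤) zero_lt_one fun h => hx0 ?_)
      rw [Module.End.maxGenEigenspace, h] at hx
      exact (Submodule.mem_bot ℂ).1 hx
    refine tendsto_exp_neg_smul_mulVec_of_mem_genEigenspace B (hB μ hμ) (k := k) ?_
    rw [← hk, ← Matrix.toLin'_apply, Matrix.toLin'_pow]
    simp [Module.End.one_eq_id]

theorem tendsto_exp_neg_smul {n : ℕ} (A : Matrix (Fin n) (Fin n) ℝ)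
    (hA : ∀ μ ∈ eigenvals A, 0 < μ.re) (i j : Fin n) :
    Tendsto (fun t : ℝ => NormedSpace.exp (-t • A) i j) atTop (𝓝 0) := by
  have h := tendsto_exp_neg_smul_mulVec _ hA (Pi.single j 1)
  have h1 := (tendsto_pi_nhds.1 h) i
  have h2 := Complex.continuous_re.tendsto _ |>.comp h1
  refine h2.congr fun t => ?_
  have : -(t : ℂ) • A.map (algebraMap ℝ ℂ) = (-t • A).map (algebraMap ℝ ℂ) := by
    ext; simp
  simp only [Function.comp, this, ← map_ofReal_exp]
  simp

theorem tendsto_exp_neg_smul_matrix {n : ℕ} (A : Matrix (Fin n) (Fin n) ℝ)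
    (hA : ∀ μ ∈ eigenvals A, 0 < μ.re) :
    Tendsto (fun t : ℝ => NormedSpace.exp (-t • A)) atTop (𝓝 0) :=
  tendsto_pi_nhds.2 fun i => tendsto_pi_nhds.2 fun j => tendsto_exp_neg_smul A hA i j

theorem trace_pos {n : ℕ} (hn : 0 < n) (A : Matrix (Fin n) (Fin n) ℝ)
    (hA : ∀ μ ∈ eigenvals A, 0 < μ.re) : 0 < A.trace := by
  have h := Matrix.trace_eq_sum_roots_charpoly (A.map (algebraMap ℝ ℂ))
  have h1 : (A.trace : ℂ) = (A.map (algebraMap ℝ ℂ)).trace := by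
    simp [Matrix.trace]
  rw [← h1] at h
  have h2 : A.trace = (((A.map (algebraMap ℝ ℂ)).charpoly.roots).map Complex.re).sum := by
    have := congrArg Complex.re h
    rw [Complex.ofReal_re] at this
    rw [this]
    exact map_multiset_sum Complex.reAddGroupHom _
  rw [h2]
  have hpos : ∀ x ∈ (A.map (algebraMap ℝ ℂ)).charpoly.roots.map Complex.re, 0 < x := by
    intro x hx
    obtain ⟨μ, hμ, rfl⟩ := Multiset.mem_map.1 hx
    exact hA μ (Matrix.mem_spectrum_iff_isRoot_charpoly.2 (Polynomial.isRoot_of_mem_roots hμ))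
  have hcard : 0 < Multiset.card ((A.map (algebraMap ℝ ℂ)).charpoly.roots.map Complex.re) := by
    rw [Multiset.card_map, ← (IsAlgClosed.splits _).natDegree_eq_card_roots,
      Matrix.charpoly_natDegree_eq_dim]
    simpa using hn
  obtain ⟨a, ha⟩ := Multiset.card_pos_iff_exists_mem.1 hcard
  exact (hpos a ha).trans_le (Multiset.single_le_sum (fun x hx => (hpos x hx).le) a ha)

/-! ### The action of `c^A` on vectors -/

theorem powAct_powAct {n : ℕ} {a b : ℝ} (ha : 0 < a) (hb : 0 < b) (A : Matrix (Fin n) (Fin n) ℝ)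
    (x : EuclideanSpace ℝ (Fin n)) : powAct a A (powAct b A x) = powAct (a * b) A x := by
  simp only [powAct, Matrix.mulVec_mulVec, ← exp_add_smul_matrix, Real.log_mul ha.ne' hb.ne']

theorem powAct_one {n : ℕ} (A : Matrix (Fin n) (Fin n) ℝ)
    (x : EuclideanSpace ℝ (Fin n)) : powAct 1 A x = x := by
  simp [powAct]

theorem powAct_powAct_inv {n : ℕ} {a : ℝ} (ha : 0 < a) (A : Matrix (Fin n) (Fin n) ℝ)
    (x : EuclideanSpace ℝ (Fin n)) : powAct a A (powAct a⁻¹ A x) = x := by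
  rw [powAct_powAct ha (inv_pos.2 ha), mul_inv_cancel₀ ha.ne', powAct_one]

theorem powAct_sub {n : ℕ} (c : ℝ) (A : Matrix (Fin n) (Fin n) ℝ)
    (x y : EuclideanSpace ℝ (Fin n)) : powAct c A (x - y) = powAct c A x - powAct c A y := by
  simp [powAct, Matrix.mulVec_sub]

/-- Lets a scaling of the frequency variable be read as a scaling of the space variable. -/
theorem inner_powAct_transpose {n : ℕ} (c : ℝ) (A : Matrix (Fin n) (Fin n) ℝ)
    (x ξ : EuclideanSpace ℝ (Fin n)) :
    inner ℝ x (powAct c Aᵀ ξ) = inner ℝ (powAct c A x) ξ := by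
  simp only [powAct, ← Matrix.transpose_smul, Matrix.exp_transpose]
  rw [EuclideanSpace.inner_eq_star_dotProduct, EuclideanSpace.inner_eq_star_dotProduct]
  simp [Matrix.mulVec_transpose, Matrix.dotProduct_mulVec, dotProduct_comm, star_trivial]

theorem powAct_eq_toEuclideanCLM {n : ℕ} (c : ℝ) (A : Matrix (Fin n) (Fin n) ℝ)
    (x : EuclideanSpace ℝ (Fin n)) :
    powAct c A x = Matrix.toEuclideanCLM (𝕜 := ℝ) (NormedSpace.exp (Real.log c • A)) x := rfl

theorem exists_norm_powAct_le {n : ℕ} (A : Matrix (Fin n) (Fin n) ℝ)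
    (hA : ∀ μ ∈ eigenvals A, 0 < μ.re) {η : ℝ} (hη : 0 < η) :
    ∃ c₀ > 0, ∀ c, 0 < c → c ≤ c₀ → ∀ x, ‖powAct c A x‖ ≤ η * ‖x‖ := by
  have hc : Continuous (fun M : Matrix (Fin n) (Fin n) ℝ => Matrix.toEuclideanCLM (𝕜 := ℝ) M) :=
    (Matrix.toEuclideanCLM (𝕜 := ℝ) (n := Fin n)).toAlgEquiv.toLinearMap.continuous_of_finiteDimensional
  have h := ((hc.tendsto 0).comp (tendsto_exp_neg_smul_matrix A hA)).norm
  rw [map_zero, norm_zero] at h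
  obtain ⟨T, hT⟩ := eventually_atTop.1 (h.eventually_lt_const hη)
  refine ⟨Real.exp (-T), Real.exp_pos _, fun c hc0 hcT x => ?_⟩
  have h1 : T ≤ -Real.log c := by
    have := Real.log_le_log hc0 hcT
    rw [Real.log_exp] at this
    linarith
  have h2 := hT _ h1
  rw [powAct_eq_toEuclideanCLM]
  refine (ContinuousLinearMap.le_opNorm _ _).trans (mul_le_mul_of_nonneg_right ?_ (norm_nonneg _))
  simpa using h2.le

theorem continuous_powAct {n : ℕ} (c : ℝ) (A : Matrix (Fin n) (Fin n) ℝ) :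
    Continuous (powAct c A) :=
  (Matrix.toEuclideanCLM (𝕜 := ℝ) (NormedSpace.exp (Real.log c • A))).continuous

/-- Linear change of variables with determinant `c^{trace A}`, by `det_exp_smul`. -/
theorem lintegral_eq_lintegral_powAct {n : ℕ} {c : ℝ} (hc : 0 < c) (A : Matrix (Fin n) (Fin n) ℝ)
    {f : EuclideanSpace ℝ (Fin n) → ENNReal} (hf : Measurable f) :
    ∫⁻ x, f x = ENNReal.ofReal (c ^ A.trace) * ∫⁻ x, f (powAct c A x) := by
  set L : EuclideanSpace ℝ (Fin n) →ₗ[ℝ] EuclideanSpace ℝ (Fin n) :=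
    (Matrix.toEuclideanCLM (𝕜 := ℝ) (NormedSpace.exp (Real.log c • A))).toLinearMap with hL
  have hdet : LinearMap.det L = c ^ A.trace := by
    rw [Real.rpow_def_of_pos hc, ← det_exp_smul]
    exact LinearMap.det_toLin (EuclideanSpace.basisFun (Fin n) ℝ).toBasis _
  have hpos : 0 < c ^ A.trace := Real.rpow_pos_of_pos hc _
  have hmap := Measure.map_linearMap_addHaar_eq_smul_addHaar
    (volume : Measure (EuclideanSpace ℝ (Fin n))) (f := L) (by rw [hdet]; exact hpos.ne')
  have h2 : ∫⁻ x, f (powAct c A x) = ∫⁻ x, f x ∂(Measure.map L volume) :=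
    (lintegral_map hf (continuous_powAct c A).measurable).symm
  rw [h2, hmap, hdet, lintegral_smul_measure, smul_eq_mul, ← mul_assoc, ← ENNReal.ofReal_mul hpos.le,
    abs_of_pos (inv_pos.2 hpos), mul_inv_cancel₀ hpos.ne', ENNReal.ofReal_one, one_mul]

/-! ### Almost orthogonality of exponentials -/

section ExponentialSums

theorem continuous_cexp_inner {V : Type*} [NormedAddCommGroup V] [InnerProductSpace ℝ V] (w : V) :
    Continuous fun η : V => Complex.exp (Complex.I * (inner ℝ w η : ℝ)) := by
  fun_prop

variable {V : Type*} [NormedAddCommGroup V] [InnerProductSpace ℝ V] [FiniteDimensional ℝ V]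
  [MeasurableSpace V] [BorelSpace V]

/-- Riemann–Lebesgue for the indicator of `K`; the factor `2π` in the threshold undoes the
normalisation of the Fourier character. -/
theorem exists_norm_integral_cexp_inner_le {K : Set V} (hK : IsCompact K) {ε : ℝ} (hε : 0 < ε) :
    ∃ T, ∀ w : V, T ≤ ‖w‖ → ‖∫ η in K, Complex.exp (Complex.I * (inner ℝ w η : ℝ))‖ ≤ ε := by
  have h := tendsto_integral_exp_inner_smul_cocompact (V := V) (K.indicator fun _ => (1 : ℂ))
  rw [← Metric.cobounded_eq_cocompact] at h
  have h1 := (h.norm.eventually_lt_const (by simpa using hε))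
  rw [← comap_norm_atTop, eventually_comap, eventually_atTop] at h1
  obtain ⟨T, hT⟩ := h1
  refine ⟨2 * Real.pi * T, fun w hw => ?_⟩
  have hpi := Real.pi_pos
  have hn : T ≤ ‖-(2 * Real.pi)⁻¹ • w‖ := by
    rw [norm_smul, norm_neg, norm_inv, Real.norm_of_nonneg (by positivity)]
    rw [← div_eq_inv_mul, le_div_iff₀ (by positivity)]
    linarith
  refine le_trans (le_of_eq ?_) (hT _ hn _ rfl).le
  rw [← integral_indicator hK.measurableSet]
  congr 2
  ext η
  by_cases hη : η ∈ K
  · simp only [Set.indicator_of_mem hη, Circle.smul_def, Real.fourierChar_apply, smul_eq_mul, mul_one]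
    congr 1
    rw [inner_smul_right, real_inner_comm]
    push_cast
    field_simp
  · simp [hη]

theorem normSq_add_add (u v w : ℂ) :
    ‖u + v + w‖ ^ 2 = ‖u‖ ^ 2 + ‖v‖ ^ 2 + ‖w‖ ^ 2 + 2 * (u * (starRingEnd ℂ) v).re +
      2 * (u * (starRingEnd ℂ) w).re + 2 * (v * (starRingEnd ℂ) w).re := by
  simp only [← Complex.normSq_eq_norm_sq, Complex.normSq_apply, Complex.add_re, Complex.add_im,
    Complex.mul_re, Complex.conj_re, Complex.conj_im]
  ring

theorem norm_cexp_I_mul_ofReal (r : ℝ) : ‖Complex.exp (Complex.I * (r : ℝ))‖ = 1 := by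
  rw [mul_comm, Complex.norm_exp_ofReal_mul_I]

theorem conj_cexp_I_mul_ofReal (r : ℝ) :
    (starRingEnd ℂ) (Complex.exp (Complex.I * (r : ℝ))) = Complex.exp (Complex.I * (-r : ℝ)) := by
  rw [← Complex.exp_conj]; simp

/-- Three characters whose frequencies are far apart are almost orthogonal over `K`. -/
theorem exists_le_integral_norm_sq_exponential_sum {K : Set V} (hK : IsCompact K)
    (hK0 : 0 < volume.real K) :
    ∃ T, ∀ a b : V, T ≤ ‖a‖ → T ≤ ‖b‖ → T ≤ ‖a - b‖ → ∀ A B C : ℂ,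
      volume.real K / 2 * (‖A‖ ^ 2 + ‖B‖ ^ 2 + ‖C‖ ^ 2) ≤
        ∫ η in K, ‖A * Complex.exp (Complex.I * (inner ℝ a η : ℝ)) +
          B * Complex.exp (Complex.I * (inner ℝ b η : ℝ)) + C‖ ^ 2 := by
  -- With `ε = |K|/4`, a cross term costs at most `|K|/4` times the sum of its two squares. Each
  -- square lies in two cross terms, so half of the diagonal survives.
  obtain ⟨T, hT⟩ := exists_norm_integral_cexp_inner_le hK (ε := volume.real K / 4) (by positivity)
  refine ⟨T, fun a b ha hb hab A B C => ?_⟩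
  set v := volume.real K with hv
  have hint (w : V) : IntegrableOn (fun η => Complex.exp (Complex.I * (inner ℝ w η : ℝ))) K :=
    (continuous_cexp_inner w).continuousOn.integrableOn_compact hK
  have hre (k : ℂ) (w : V) (hw : T ≤ ‖w‖) :
      -(‖k‖ * (v / 4)) ≤ ∫ η in K, (k * Complex.exp (Complex.I * (inner ℝ w η : ℝ))).re := by
    have h1 : ∫ η in K, (k * Complex.exp (Complex.I * (inner ℝ w η : ℝ))).re =
        (k * ∫ η in K, Complex.exp (Complex.I * (inner ℝ w η : ℝ))).re := by
      rw [← integral_const_mul]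
      exact integral_re ((hint w).const_mul k)
    rw [h1]
    refine (abs_le.1 ((Complex.abs_re_le_norm _).trans ?_)).1
    rw [norm_mul]
    exact mul_le_mul_of_nonneg_left (hT w hw) (norm_nonneg _)
  have hreint (k : ℂ) (w : V) :
      IntegrableOn (fun η => (k * Complex.exp (Complex.I * (inner ℝ w η : ℝ))).re) K :=
    ((hint w).const_mul k).re
  have hexp (η : V) : ‖A * Complex.exp (Complex.I * (inner ℝ a η : ℝ)) +
          B * Complex.exp (Complex.I * (inner ℝ b η : ℝ)) + C‖ ^ 2 =
      (‖A‖ ^ 2 + ‖B‖ ^ 2 + ‖C‖ ^ 2) +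
        (2 * (A * (starRingEnd ℂ) B * Complex.exp (Complex.I * (inner ℝ (a - b) η : ℝ))).re +
        (2 * (A * (starRingEnd ℂ) C * Complex.exp (Complex.I * (inner ℝ a η : ℝ))).re +
        2 * (B * (starRingEnd ℂ) C * Complex.exp (Complex.I * (inner ℝ b η : ℝ))).re)) := by
    rw [normSq_add_add, norm_mul, norm_mul, norm_cexp_I_mul_ofReal, norm_cexp_I_mul_ofReal,
      map_mul, conj_cexp_I_mul_ofReal]
    have e1 : Complex.exp (Complex.I * (inner ℝ (a - b) η : ℝ)) =
      Complex.exp (Complex.I * (inner ℝ a η : ℝ)) * Complex.exp (Complex.I * (-(inner ℝ b η) : ℝ)) := by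
      rw [← Complex.exp_add, inner_sub_left]; congr 1; push_cast; ring
    rw [e1]
    ring_nf
  have hfin : IsFiniteMeasure (volume.restrict K) := ⟨by simpa using hK.measure_lt_top⟩
  have hsum (c : ℝ) (f g h : V → ℝ) (hf : IntegrableOn f K) (hg : IntegrableOn g K)
      (hh : IntegrableOn h K) : ∫ η in K, (c + (2 * f η + (2 * g η + 2 * h η))) =
        v * c + (2 * (∫ η in K, f η) + (2 * (∫ η in K, g η) + 2 * ∫ η in K, h η)) := by
    have h1 : IntegrableOn (fun η => 2 * g η + 2 * h η) K := (hg.const_mul 2).add (hh.const_mul 2)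
    have h2 : IntegrableOn (fun η => 2 * f η + (2 * g η + 2 * h η)) K := (hf.const_mul 2).add h1
    rw [integral_add (integrable_const _) h2, integral_add (hf.const_mul 2) h1,
      integral_add (hg.const_mul 2) (hh.const_mul 2), integral_const_mul, integral_const_mul,
      integral_const_mul, integral_const, smul_eq_mul, measureReal_restrict_apply_univ]
  rw [integral_congr_ae (Eventually.of_forall hexp), hsum _ _ _ _ (hreint _ _) (hreint _ _) (hreint _ _)]
  have i1 := hre (A * (starRingEnd ℂ) B) _ hab
  have i2 := hre (A * (starRingEnd ℂ) C) _ ha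
  have i3 := hre (B * (starRingEnd ℂ) C) _ hb
  simp only [norm_mul, RCLike.norm_conj] at i1 i2 i3
  have j1 := mul_le_mul_of_nonneg_right (two_mul_le_add_sq ‖A‖ ‖B‖) hK0.le
  have j2 := mul_le_mul_of_nonneg_right (two_mul_le_add_sq ‖A‖ ‖C‖) hK0.le
  have j3 := mul_le_mul_of_nonneg_right (two_mul_le_add_sq ‖B‖ ‖C‖) hK0.le
  nlinarith

end ExponentialSums

/-! ### Elementary bounds on the factors of the kernel -/

theorem isCompact_box {n : ℕ} (a b : ℝ) :
    IsCompact {x : EuclideanSpace ℝ (Fin n) | ∀ k, x k ∈ Set.Icc a b} := by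
  have h := (isCompact_univ_pi fun _ : Fin n => isCompact_Icc (a := a) (b := b)).image
    (PiLp.continuous_toLp 2 fun _ : Fin n => ℝ)
  convert h using 1
  ext x
  simp only [Set.mem_ofPred_eq, Set.mem_image, Set.mem_pi, Set.mem_univ, true_imp_iff]
  exact ⟨fun hx => ⟨x.ofLp, hx, rfl⟩, by rintro ⟨y, hy, rfl⟩; exact hy⟩

theorem volume_box_pos {n : ℕ} {a b : ℝ} (hab : a < b) :
    0 < volume {x : EuclideanSpace ℝ (Fin n) | ∀ k, x k ∈ Set.Icc a b} := by
  have ho : IsOpen {x : EuclideanSpace ℝ (Fin n) | ∀ k, x k ∈ Set.Ioo a b} := by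
    simp only [Set.ofPred_forall]
    exact isOpen_iInter_of_finite fun k => isOpen_Ioo.preimage (by fun_prop)
  have hne : {x : EuclideanSpace ℝ (Fin n) | ∀ k, x k ∈ Set.Ioo a b}.Nonempty :=
    ⟨WithLp.toLp 2 fun _ => (a + b) / 2, fun k => ⟨by simp; linarith, by simp; linarith⟩⟩
  exact (ho.measure_pos volume hne).trans_le
    (measure_mono fun x hx k => Set.Ioo_subset_Icc_self (hx k))

/-- On the box `[1/n, 2/n]^n` the inner product with `x` lies in `[1/2, 2]`, so `|e^{ir} - 1| =
2|sin(r/2)|` has its half-angle in `[1/4, 1]`. This supplies the boxes for the blocks other than the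
first. -/
theorem exists_le_norm_cexp_sub_one {n : ℕ} (hn : 0 < n) (ψ : EuclideanSpace ℝ (Fin n) → ℝ)
    (hψc : Continuous ψ) (hψnonneg : ∀ x, 0 ≤ ψ x) (hψne : ∀ x, x ≠ 0 → ψ x ≠ 0) {s : ℝ} (hs : 0 ≤ s) :
    ∃ (Q : Set (EuclideanSpace ℝ (Fin n))) (c : ℝ), MeasurableSet Q ∧ 0 < volume Q ∧ volume Q < ⊤ ∧
      0 < c ∧ ∀ ξ ∈ Q, c ≤ ψ ξ ^ (-s) ∧ ∀ x : EuclideanSpace ℝ (Fin n),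
        (∀ k, x k ∈ Set.Ico (1 / 2 : ℝ) 1) → c ≤ ‖Complex.exp (Complex.I * (inner ℝ x ξ : ℝ)) - 1‖ := by
  have hn' : (0 : ℝ) < n := Nat.cast_pos.2 hn
  set Q := {ξ : EuclideanSpace ℝ (Fin n) | ∀ k, ξ k ∈ Set.Icc (1 / n : ℝ) (2 / n)} with hQ
  have hQc : IsCompact Q := isCompact_box _ _
  obtain ⟨M, hM⟩ := hQc.exists_bound_of_continuousOn hψc.continuousOn
  have hM1 : 0 < max M 1 := lt_max_of_lt_right one_pos
  have hsin : 0 < Real.sin (1 / 4) :=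
    Real.sin_pos_of_pos_of_lt_pi (by norm_num) (by linarith [Real.pi_gt_three])
  refine ⟨Q, min (max M 1 ^ (-s)) (2 * Real.sin (1 / 4)), hQc.measurableSet,
    volume_box_pos (by gcongr; norm_num), hQc.measure_lt_top,
    lt_min (Real.rpow_pos_of_pos hM1 _) (by positivity), fun ξ hξ => ⟨?_, fun x hx => ?_⟩⟩
  · refine (min_le_left _ _).trans ?_
    have hξ0 : ξ ≠ 0 := by
      rintro rfl
      have := (hξ ⟨0, hn⟩).1
      simp at this
      omega
    have hpos : 0 < ψ ξ := (hψnonneg ξ).lt_of_ne' (hψne ξ hξ0)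
    exact Real.rpow_le_rpow_of_nonpos hpos
      (((le_abs_self _).trans (hM ξ hξ)).trans (le_max_left _ _)) (by linarith)
  · refine (min_le_right _ _).trans ?_
    have hin : (inner ℝ x ξ : ℝ) = ∑ k, x k * ξ k := by
      simp [PiLp.inner_apply, mul_comm]
    have h1 : 1 / 2 ≤ (inner ℝ x ξ : ℝ) := by
      rw [hin]
      calc (1 / 2 : ℝ) = ∑ _k : Fin n, (1 / 2 : ℝ) * (1 / n) := by simp; field_simp
        _ ≤ _ := Finset.sum_le_sum fun k _ =>
          mul_le_mul (hx k).1 (hξ k).1 (by positivity) (by linarith [(hx k).1])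
    have h2 : (inner ℝ x ξ : ℝ) ≤ 2 := by
      rw [hin]
      calc ∑ k, x k * ξ k ≤ ∑ _k : Fin n, (1 : ℝ) * (2 / n) := Finset.sum_le_sum fun k _ =>
            mul_le_mul (hx k).2.le (hξ k).2 (le_trans (by positivity) (hξ k).1) one_pos.le
        _ = 2 := by simp; field_simp
    rw [Complex.norm_exp_I_mul_ofReal_sub_one, norm_mul, Real.norm_ofNat]
    refine mul_le_mul_of_nonneg_left ?_ two_pos.le
    refine le_trans ?_ (le_abs_self _)
    refine Real.sin_le_sin_of_le_of_le_pi_div_two ?_ ?_ ?_ <;> linarith [Real.pi_gt_three]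

theorem norm_cexp_sub_one_le (r : ℝ) : ‖Complex.exp (Complex.I * (r : ℝ)) - 1‖ ≤ 2 := by
  refine (norm_sub_le _ _).trans ?_
  rw [norm_cexp_I_mul_ofReal, norm_one]; norm_num

/-- Passes from an `L²` lower bound to an `L^α` one for functions bounded by `L`: the exponent `α -
2` is nonpositive. -/
theorem rpow_mul_sq_le_rpow {L r α : ℝ} (hr : 0 ≤ r) (hrL : r ≤ L) (hα0 : 0 < α)
    (hα : α ≤ 2) : L ^ (α - 2) * r ^ 2 ≤ r ^ α := by
  rcases hr.eq_or_lt with rfl | hr0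
  · simp [Real.zero_rpow hα0.ne']
  calc L ^ (α - 2) * r ^ 2 ≤ r ^ (α - 2) * r ^ 2 :=
        mul_le_mul_of_nonneg_right
          (Real.rpow_le_rpow_of_nonpos hr0 hrL (show α - 2 ≤ 0 by linarith)) (sq_nonneg _)
    _ = r ^ α := by
        rw [← Real.rpow_natCast r 2, ← Real.rpow_add hr0]; norm_num

theorem enorm_rpow_eq_ofReal {F : Type*} [NormedAddCommGroup F] (z : F) {α : ℝ} (hα : 0 ≤ α) :
    ‖z‖ₑ ^ α = ENNReal.ofReal (‖z‖ ^ α) := by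
  rw [← ofReal_norm, ENNReal.ofReal_rpow_of_nonneg (norm_nonneg _) hα]

/-! ### Scale separation through the radial part -/

theorem IsRadialPart.exists_le_norm {n : ℕ} {A : Matrix (Fin n) (Fin n) ℝ}
    {τ : EuclideanSpace ℝ (Fin n) → ℝ} (hτ : IsRadialPart A τ) :
    ∃ δ > 0, ∀ l, τ l = 1 → δ ≤ ‖l‖ := by
  have h := hτ.continuous.tendsto 0
  rw [hτ.zero] at h
  obtain ⟨δ, hδ, h1⟩ := Metric.eventually_nhds_iff.1 (h.eventually_lt_const one_pos)
  refine ⟨δ, hδ, fun l hl => ?_⟩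
  by_contra! hlt
  have := h1 (y := l) (by simpa using hlt)
  linarith

/-- There is a scale `ε τ(x - y)` at which `x`, `y` and `0` are all far apart. -/
theorem IsRadialPart.exists_le_norm_powAct {n : ℕ} (hn : 0 < n) {A : Matrix (Fin n) (Fin n) ℝ}
    (hA : ∀ μ ∈ eigenvals A, 0 < μ.re) {τ : EuclideanSpace ℝ (Fin n) → ℝ} (hτ : IsRadialPart A τ)
    (T : ℝ) :
    ∃ ε > 0, ∀ x y : EuclideanSpace ℝ (Fin n), (∀ k, x k ∈ Set.Ico (1 / 2 : ℝ) 1) →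
      (∀ k, y k ∈ Set.Ico (1 / 2 : ℝ) 1) → x ≠ y →
      T ≤ ‖powAct (ε * τ (x - y))⁻¹ A x‖ ∧ T ≤ ‖powAct (ε * τ (x - y))⁻¹ A y‖ ∧
      T ≤ ‖powAct (ε * τ (x - y))⁻¹ A x - powAct (ε * τ (x - y))⁻¹ A y‖ := by
  obtain ⟨δ, hδ, hδ1⟩ := hτ.exists_le_norm
  set T' := max T 1 with hT'
  have hT0 : 0 < T' := lt_max_of_lt_right one_pos
  -- Chosen so that if `g^A` contracts by `η`, then `g^{-A}` carries every vector of norm at least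
  -- `min δ (1/2)` to norm at least `T'`.
  set η := min δ (1 / 2) / T' with hη
  have hη0 : 0 < η := by positivity
  have hηT : η * T' = min δ (1 / 2) := div_mul_cancel₀ _ hT0.ne'
  obtain ⟨c₀, hc₀, hc⟩ := exists_norm_powAct_le A hA hη0
  obtain ⟨M, hM⟩ := (isCompact_box (n := n) (-1) 1).exists_bound_of_continuousOn hτ.continuous.continuousOn
  set M' := max M 1 with hM'
  have hM0 : 0 < M' := lt_max_of_lt_right one_pos
  have hM1 : 1 ≤ M' := le_max_right _ _
  have hfar (g : ℝ) (hg : 0 < g) (hgc : g ≤ c₀) (u : EuclideanSpace ℝ (Fin n)) (hu : min δ (1 / 2) ≤ ‖u‖) :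
      T ≤ ‖powAct g⁻¹ A u‖ := by
    have h1 := hc g hg hgc (powAct g⁻¹ A u)
    rw [powAct_powAct_inv hg] at h1
    refine (le_max_left T 1).trans ?_
    rw [← hT']
    refine le_of_mul_le_mul_left ?_ hη0
    rw [hηT]
    exact hu.trans h1
  have hnorm (x : EuclideanSpace ℝ (Fin n)) (hx : ∀ k, x k ∈ Set.Ico (1 / 2 : ℝ) 1) :
      min δ (1 / 2) ≤ ‖x‖ := by
    refine (min_le_right _ _).trans ((hx ⟨0, hn⟩).1.trans ((le_abs_self _).trans ?_))
    exact PiLp.norm_apply_le x _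
  -- `M'` bounds `τ` on all differences `x - y`, so `ε τ(x - y) ≤ c₀`; and `M' ≥ 1`, so `ε ≤ c₀` as
  -- well.
  refine ⟨c₀ / M', by positivity, fun x y hx hy hxy => ?_⟩
  have hpos := hτ.pos (x - y) (sub_ne_zero.2 hxy)
  have hle : τ (x - y) ≤ M' := by
    refine (le_abs_self _).trans ((hM (x - y) fun k => ?_).trans (le_max_left _ _))
    have h1 := hx k
    have h2 := hy k
    simp only [PiLp.sub_apply, Set.mem_Icc]
    exact ⟨by linarith [h1.1, h2.2], by linarith [h1.2, h2.1]⟩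
  have hg0 : 0 < c₀ / M' * τ (x - y) := by positivity
  have hgc : c₀ / M' * τ (x - y) ≤ c₀ := by
    rw [div_mul_eq_mul_div, div_le_iff₀ hM0]
    gcongr
  refine ⟨hfar _ hg0 hgc x (hnorm x hx), hfar _ hg0 hgc y (hnorm y hy), ?_⟩
  obtain ⟨l, hl, hxl⟩ := hτ.polar (x - y) (sub_ne_zero.2 hxy)
  -- The factor `τ(x - y)` cancels in polar coordinates: the rescaled difference is `ε^{-A} l` with
  -- `l` on the unit sphere, however close `x` and `y` are.
  have h1 : powAct (c₀ / M' * τ (x - y))⁻¹ A (x - y) = powAct (c₀ / M')⁻¹ A l := by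
    refine (congrArg _ hxl).trans ?_
    rw [powAct_powAct (inv_pos.2 hg0) hpos]
    congr 1
    field_simp
  rw [← powAct_sub, h1]
  exact hfar _ (by positivity) (div_le_self hc₀.le hM1) l ((min_le_left _ _).trans (hδ1 l hl))

/-! ### Lower bound for the kernel integral -/

/-- Allowing unrelated `z` and `w` is what makes the remaining blocks harmless: they enter only as
two bounded coefficients. -/
theorem exists_le_lintegral_first_factor {n : ℕ} (hn : 0 < n) {A : Matrix (Fin n) (Fin n) ℝ}
    (hA : ∀ μ ∈ eigenvals A, 0 < μ.re) {ψ : EuclideanSpace ℝ (Fin n) → ℝ} (hψc : Continuous ψ)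
    (hψh : IsHomogeneous Aᵀ ψ) (hψnonneg : ∀ x, 0 ≤ ψ x) (hψne : ∀ x, x ≠ 0 → ψ x ≠ 0)
    {α : ℝ} (hα0 : 0 < α) (hα2 : α ≤ 2) {H : ℝ} (hH : 0 < H)
    {τ : EuclideanSpace ℝ (Fin n) → ℝ} (hτ : IsRadialPart A τ) {M : ℝ} (hM : 0 < M) :
    ∃ c > 0, ∀ x y : EuclideanSpace ℝ (Fin n), (∀ k, x k ∈ Set.Ico (1 / 2 : ℝ) 1) →
      (∀ k, y k ∈ Set.Ico (1 / 2 : ℝ) 1) → ∀ z w : ℂ, ‖z‖ ≤ M → ‖w‖ ≤ M →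
      ENNReal.ofReal (c * τ (x - y) ^ (α * H) * ‖z‖ ^ 2) ≤
        ∫⁻ ξ, ‖(z * (Complex.exp (Complex.I * (inner ℝ x ξ : ℝ)) - 1) -
          w * (Complex.exp (Complex.I * (inner ℝ y ξ : ℝ)) - 1)) *
            ((ψ ξ ^ (-H - A.trace / α) : ℝ) : ℂ)‖ₑ ^ α := by
  set K := Metric.closedBall (0 : EuclideanSpace ℝ (Fin n)) 1 with hK
  have hKc : IsCompact K := isCompact_closedBall _ _
  have hv : 0 < volume.real K :=
    ENNReal.toReal_pos (Metric.measure_closedBall_pos volume _ one_pos).ne' hKc.measure_lt_top.ne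
  obtain ⟨T, hT⟩ := exists_le_integral_norm_sq_exponential_sum hKc hv
  obtain ⟨ε, hε, hfar⟩ := hτ.exists_le_norm_powAct hn hA T
  obtain ⟨R₀, hR₀⟩ := hKc.exists_bound_of_continuousOn hψc.continuousOn
  set R := max R₀ 1 with hR
  have hR0 : 0 < R := lt_max_of_lt_right one_pos
  set q := A.trace with hq
  have hq0 : 0 < q := trace_pos hn A hA
  set s := H + q / α with hs
  have hs0 : 0 < s := by positivity
  have hL : 0 < 4 * M := by positivity
  -- The factors come from the passage from `L²` to `L^α`, from `ψ ≤ R` on the unit ball, from `g =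
  -- ε τ(x - y)`, and from almost orthogonality.
  refine ⟨(4 * M) ^ (α - 2) * R ^ (-(α * s)) * ε ^ (α * H) * (volume.real K / 2), by positivity,
    fun x y hx hy z w hz hw => ?_⟩
  by_cases hxy : x = y
  · simp [hxy, hτ.zero, Real.zero_rpow (mul_pos hα0 hH).ne']
  obtain ⟨ha, hb, hab⟩ := hfar x y hx hy hxy
  have hh := hτ.pos (x - y) (sub_ne_zero.2 hxy)
  set h := τ (x - y)
  set g := ε * h with hg
  have hg0 : 0 < g := mul_pos hε hh
  set a := powAct g⁻¹ A x
  set b := powAct g⁻¹ A y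
  have hmeas : Measurable fun ξ => ‖(z * (Complex.exp (Complex.I * (inner ℝ x ξ : ℝ)) - 1) -
          w * (Complex.exp (Complex.I * (inner ℝ y ξ : ℝ)) - 1)) *
            ((ψ ξ ^ (-H - q / α) : ℝ) : ℂ)‖ₑ ^ α := by
    have := hψc.measurable
    fun_prop
  rw [lintegral_eq_lintegral_powAct (inv_pos.2 hg0) Aᵀ hmeas, Matrix.trace_transpose]
  set k := (4 * M) ^ (α - 2) * R ^ (-(α * s)) * g ^ (α * s) with hk
  have hk0 : 0 ≤ k := by positivity
  set F : EuclideanSpace ℝ (Fin n) → ℂ := fun η =>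
    z * Complex.exp (Complex.I * (inner ℝ a η : ℝ)) +
      -w * Complex.exp (Complex.I * (inner ℝ b η : ℝ)) + (w - z) with hF
  have hFc : Continuous F := by
    have := continuous_cexp_inner a
    have := continuous_cexp_inner b
    fun_prop
  have hpt (η : EuclideanSpace ℝ (Fin n)) (hη : η ∈ K) (hη0 : η ≠ 0) :
      ENNReal.ofReal (k * ‖F η‖ ^ 2) ≤
      ‖(z * (Complex.exp (Complex.I * (inner ℝ x (powAct g⁻¹ Aᵀ η) : ℝ)) - 1) -
          w * (Complex.exp (Complex.I * (inner ℝ y (powAct g⁻¹ Aᵀ η) : ℝ)) - 1)) *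
            ((ψ (powAct g⁻¹ Aᵀ η) ^ (-H - q / α) : ℝ) : ℂ)‖ₑ ^ α := by
    rw [inner_powAct_transpose, inner_powAct_transpose, hψh _ (inv_pos.2 hg0),
      enorm_rpow_eq_ofReal _ hα0.le]
    refine ENNReal.ofReal_le_ofReal ?_
    have hψ0 : 0 < ψ η := (hψnonneg η).lt_of_ne' (hψne η hη0)
    have hψR : ψ η ≤ R := ((le_abs_self _).trans (hR₀ η hη)).trans (le_max_left _ _)
    have hFe : z * (Complex.exp (Complex.I * (inner ℝ a η : ℝ)) - 1) -
        w * (Complex.exp (Complex.I * (inner ℝ b η : ℝ)) - 1) = F η := by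
      simp only [hF]; ring
    have hFL : ‖F η‖ ≤ 4 * M := by
      rw [← hFe]
      refine (norm_sub_le _ _).trans ?_
      rw [norm_mul, norm_mul]
      have h1 := mul_le_mul hz (norm_cexp_sub_one_le (inner ℝ a η)) (norm_nonneg _) hM.le
      have h2 := mul_le_mul hw (norm_cexp_sub_one_le (inner ℝ b η)) (norm_nonneg _) hM.le
      linarith
    rw [hFe, norm_mul, Complex.norm_real, Real.norm_of_nonneg (by positivity),
      Real.mul_rpow (norm_nonneg _) (by positivity), ← Real.rpow_mul (by positivity)]
    have e1 : (-H - q / α) * α = -(α * s) := by rw [hs]; ring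
    rw [e1]
    have h3 : R ^ (-(α * s)) * g ^ (α * s) ≤ (g⁻¹ * ψ η) ^ (-(α * s)) := by
      rw [Real.mul_rpow (by positivity) hψ0.le, Real.inv_rpow hg0.le, Real.rpow_neg hg0.le, inv_inv,
        mul_comm]
      gcongr _ * ?_
      exact Real.rpow_le_rpow_of_nonpos hψ0 hψR (by linarith [mul_pos hα0 hs0])
    have h4 := rpow_mul_sq_le_rpow (norm_nonneg (F η)) hFL hα0 hα2
    calc k * ‖F η‖ ^ 2 = ((4 * M) ^ (α - 2) * ‖F η‖ ^ 2) * (R ^ (-(α * s)) * g ^ (α * s)) := by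
          rw [hk]; ring
      _ ≤ _ := mul_le_mul h4 h3 (by positivity) (by positivity)
  -- The constant term `w - z` is the character of frequency `0`; of the three squares only `‖z‖²`
  -- is kept.
  have hlow := hT a b ha hb hab z (-w) (w - z)
  have hint : IntegrableOn (fun η => k * ‖F η‖ ^ 2) K := by
    refine ContinuousOn.integrableOn_compact hKc (Continuous.continuousOn ?_)
    fun_prop
  -- The pointwise bound needs `ψ η > 0`, which is available only away from the origin.
  have hnz : ∀ᵐ η ∂(volume.restrict K), η ≠ 0 := by
    have : Nonempty (Fin n) := ⟨⟨0, hn⟩⟩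
    exact ae_restrict_of_ae (Measure.ae_ne volume 0)
  calc ENNReal.ofReal ((4 * M) ^ (α - 2) * R ^ (-(α * s)) * ε ^ (α * H) * (volume.real K / 2) *
        h ^ (α * H) * ‖z‖ ^ 2)
      ≤ ENNReal.ofReal (g⁻¹ ^ q * ∫ η in K, k * ‖F η‖ ^ 2) := by
        refine ENNReal.ofReal_le_ofReal ?_
        rw [integral_const_mul]
        -- Since `αs = αH + q`, the Jacobian `g^{-q}` removes the trace part and leaves `g^{αH}`.
        have e2 : g⁻¹ ^ q * k = (4 * M) ^ (α - 2) * R ^ (-(α * s)) * (ε ^ (α * H) * h ^ (α * H)) := by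
          have e3 : α * s = α * H + q := by rw [hs]; field_simp
          rw [hk, ← Real.mul_rpow hε.le hh.le, ← hg, Real.inv_rpow hg0.le]
          have : g ^ (α * s) = g ^ (α * H) * g ^ q := by rw [e3, Real.rpow_add hg0]
          rw [this]
          have : 0 < g ^ q := Real.rpow_pos_of_pos hg0 _
          field_simp
        rw [← mul_assoc, e2]
        have h5 : volume.real K / 2 * ‖z‖ ^ 2 ≤ ∫ η in K, ‖F η‖ ^ 2 := by
          refine le_trans ?_ hlow
          gcongr
          linarith [sq_nonneg ‖-w‖, sq_nonneg ‖w - z‖]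
        calc _ = (4 * M) ^ (α - 2) * R ^ (-(α * s)) * (ε ^ (α * H) * h ^ (α * H)) *
              (volume.real K / 2 * ‖z‖ ^ 2) := by ring
          _ ≤ _ := by gcongr
    _ = ENNReal.ofReal (g⁻¹ ^ q) * ∫⁻ η in K, ENNReal.ofReal (k * ‖F η‖ ^ 2) := by
        rw [ENNReal.ofReal_mul (by positivity), ofReal_integral_eq_lintegral_ofReal hint
          (Eventually.of_forall fun η => by positivity)]
    _ ≤ _ := by
        refine mul_le_mul' le_rfl ?_
        refine le_trans (lintegral_mono_ae ?_) (setLIntegral_le_lintegral K _)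
        filter_upwards [hnz, ae_restrict_mem hKc.measurableSet] with η hη0 hη using hpt η hη hη0

theorem measurable_kernel {m : ℕ} {d : Fin m → ℕ} (α : ℝ) (E : ∀ j, Matrix (Fin (d j)) (Fin (d j)) ℝ)
    {ψ : ∀ j, EuclideanSpace ℝ (Fin (d j)) → ℝ} (hψc : ∀ j, Continuous (ψ j)) (H : Fin m → ℝ)
    (x : Space d) : Measurable (kernel α E ψ H x) := by
  unfold kernel
  refine Finset.measurable_fun_prod _ fun j _ => ?_
  have := (hψc j).measurable
  have h2 : Measurable fun ξ : Space d => ξ j := measurable_pi_apply j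
  have h3 : Measurable fun ξ : Space d => (inner ℝ (x j) (ξ j) : ℝ) :=
    (continuous_const.inner continuous_id).measurable.comp h2
  have h4 : Measurable fun ξ : Space d => ψ j (ξ j) := this.comp h2
  fun_prop

theorem exists_le_lintegral_kernel_succ {n : ℕ} {d : Fin (n + 1) → ℕ} (hd : ∀ j, 0 < d j)
    {E : ∀ j, Matrix (Fin (d j)) (Fin (d j)) ℝ} (hE : ∀ j, ∀ μ ∈ eigenvals (E j), 0 < μ.re)
    {ψ : ∀ j, EuclideanSpace ℝ (Fin (d j)) → ℝ} (hψc : ∀ j, Continuous (ψ j))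
    (hψh : ∀ j, IsHomogeneous (E j)ᵀ (ψ j)) (hψnonneg : ∀ j x, 0 ≤ ψ j x)
    (hψne : ∀ j x, x ≠ 0 → ψ j x ≠ 0) {α : ℝ} (hα0 : 0 < α) (hα2 : α ≤ 2)
    {H : Fin (n + 1) → ℝ} (hH0 : ∀ j, 0 < H j)
    {τ : EuclideanSpace ℝ (Fin (d 0)) → ℝ} (hτ : IsRadialPart (E 0) τ) :
    ∃ c > 0, ∀ x y : Space d, (∀ j k, x j k ∈ Set.Ico (1 / 2 : ℝ) 1) →
      (∀ j k, y j k ∈ Set.Ico (1 / 2 : ℝ) 1) →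
      ENNReal.ofReal (c * τ (x 0 - y 0) ^ (α * H 0)) ≤
        ∫⁻ ξ, ‖kernel α E ψ H x ξ - kernel α E ψ H y ξ‖ₑ ^ α := by
  -- `M = 2^n` because each of the `n` remaining oscillating factors has modulus at most `2`.
  obtain ⟨c, hc, hfirst⟩ := exists_le_lintegral_first_factor (hd 0) (hE 0) (hψc 0) (hψh 0)
    (hψnonneg 0) (hψne 0) hα0 hα2 (hH0 0) hτ (M := 2 ^ n) (by positivity)
  have hs (j : Fin (n + 1)) : 0 ≤ H j + (E j).trace / α :=
    add_nonneg (hH0 j).le (div_nonneg (trace_pos (hd j) _ (hE j)).le hα0.le)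
  choose Q b hQm hQ0 hQtop hb hQb using fun j : Fin n =>
    exists_le_norm_cexp_sub_one (hd (Fin.succAbove 0 j)) (ψ (Fin.succAbove 0 j))
      (hψc _) (hψnonneg _) (hψne _) (hs (Fin.succAbove 0 j))
  set R : Set ((j : Fin n) → EuclideanSpace ℝ (Fin (d (Fin.succAbove 0 j)))) := Set.univ.pi Q with hR
  have hRm : MeasurableSet R := MeasurableSet.univ_pi hQm
  have hRv : volume R = ∏ j, volume (Q j) := volume_pi_pi Q
  have hR0 : 0 < volume R := by
    rw [hRv]; exact CanonicallyOrderedAdd.prod_pos.2 fun j _ => hQ0 j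
  have hRtop : volume R < ⊤ := by
    rw [hRv]; exact ENNReal.prod_lt_top fun j _ => hQtop j
  have hRr : 0 < volume.real R := ENNReal.toReal_pos hR0.ne' hRtop.ne
  set β := ∏ j, b j with hβ
  have hβ0 : 0 < β := Finset.prod_pos fun j _ => hb j
  -- `β` bounds from below both the common weight, which enters with power `α`, and `‖z‖`, which
  -- enters squared.
  refine ⟨β ^ α * (c * β ^ 2) * volume.real R, by positivity, fun x y hx hy => ?_⟩
  set h := τ (x 0 - y 0) with hh
  set e := MeasurableEquiv.piFinSuccAbove (fun j : Fin (n + 1) => EuclideanSpace ℝ (Fin (d j))) 0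
  have hmp : MeasurePreserving e :=
    volume_preserving_piFinSuccAbove (fun j : Fin (n + 1) => EuclideanSpace ℝ (Fin (d j))) 0
  have hmeas : Measurable fun ξ => ‖kernel α E ψ H x ξ - kernel α E ψ H y ξ‖ₑ ^ α :=
    ((measurable_kernel α E hψc H x).sub (measurable_kernel α E hψc H y)).enorm.pow_const α
  have hmeas' : Measurable fun p => ‖kernel α E ψ H x (e.symm p) - kernel α E ψ H y (e.symm p)‖ₑ ^ α :=
    hmeas.comp e.symm.measurable
  rw [← (hmp.symm e).lintegral_comp hmeas, Measure.volume_eq_prod,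
    lintegral_prod_symm _ hmeas'.aemeasurable]
  set z : Space d → ((j : Fin n) → EuclideanSpace ℝ (Fin (d (Fin.succAbove 0 j)))) → ℂ := fun x η =>
    ∏ j, (Complex.exp (Complex.I * (inner ℝ (x (Fin.succAbove 0 j)) (η j) : ℝ)) - 1) with hz
  have hzM (x : Space d) η : ‖z x η‖ ≤ 2 ^ n := by
    simp only [hz, norm_prod]
    exact (Finset.prod_le_prod (fun j _ => norm_nonneg _) fun j _ => norm_cexp_sub_one_le _).trans
      (by simp)
  have hinner (η) (hη : η ∈ R) : ENNReal.ofReal (β ^ α * (c * β ^ 2) * h ^ (α * H 0)) ≤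
      ∫⁻ ξ₀, ‖kernel α E ψ H x (e.symm (ξ₀, η)) - kernel α E ψ H y (e.symm (ξ₀, η))‖ₑ ^ α := by
    set w : ℝ := ∏ j : Fin n, ψ (Fin.succAbove 0 j) (η j) ^
      (-H (Fin.succAbove 0 j) - (E (Fin.succAbove 0 j)).trace / α) with hw
    have hker (x : Space d) (ξ₀) : kernel α E ψ H x (e.symm (ξ₀, η)) =
        z x η * (w : ℂ) * ((Complex.exp (Complex.I * (inner ℝ (x 0) ξ₀ : ℝ)) - 1) *
          ((ψ 0 ξ₀ ^ (-H 0 - (E 0).trace / α) : ℝ) : ℂ)) := by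
      unfold kernel
      rw [Fin.prod_univ_succAbove _ 0, hz, hw, Complex.ofReal_prod, ← Finset.prod_mul_distrib, mul_comm]
      simp only [e, MeasurableEquiv.piFinSuccAbove_symm_apply, Fin.insertNthEquiv_apply,
        Fin.insertNth_apply_same, Fin.insertNth_apply_succAbove]
    have hwβ : β ≤ w := Finset.prod_le_prod (fun j _ => (hb j).le) fun j _ => by
      rw [← neg_add']
      exact (hQb j (η j) (hη j trivial)).1
    have hzβ : β ≤ ‖z x η‖ := by
      simp only [hz, norm_prod]
      exact Finset.prod_le_prod (fun j _ => (hb j).le) fun j _ =>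
        (hQb j (η j) (hη j trivial)).2 _ (hx _)
    have hw0 : 0 < w := hβ0.trans_le hwβ
    have hh0 : 0 ≤ h := by
      by_cases h0 : x 0 - y 0 = 0
      · simp [hh, h0, hτ.zero]
      · exact (hτ.pos _ h0).le
    calc ENNReal.ofReal (β ^ α * (c * β ^ 2) * h ^ (α * H 0))
        ≤ ENNReal.ofReal (w ^ α * (c * h ^ (α * H 0) * ‖z x η‖ ^ 2)) := by
          refine ENNReal.ofReal_le_ofReal ?_
          calc β ^ α * (c * β ^ 2) * h ^ (α * H 0) = β ^ α * (c * h ^ (α * H 0) * β ^ 2) := by ring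
            _ ≤ _ := by gcongr
      _ = ENNReal.ofReal (w ^ α) * ENNReal.ofReal (c * h ^ (α * H 0) * ‖z x η‖ ^ 2) :=
          ENNReal.ofReal_mul (by positivity)
      _ ≤ ENNReal.ofReal (w ^ α) * _ :=
          mul_le_mul' le_rfl (hfirst (x 0) (y 0) (hx 0) (hy 0) (z x η) (z y η) (hzM x η) (hzM y η))
      _ = _ := by
          rw [← lintegral_const_mul' _ _ ENNReal.ofReal_ne_top]
          refine lintegral_congr fun ξ₀ => ?_
          have : ENNReal.ofReal (w ^ α) = ‖(w : ℂ)‖ₑ ^ α := by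
            rw [enorm_rpow_eq_ofReal _ hα0.le, Complex.norm_real, Real.norm_of_nonneg hw0.le]
          rw [this, ← ENNReal.mul_rpow_of_nonneg _ _ hα0.le, ← enorm_mul, hker, hker]
          congr 2
          ring
  calc ENNReal.ofReal (β ^ α * (c * β ^ 2) * volume.real R * h ^ (α * H 0))
      = ∫⁻ _η in R, ENNReal.ofReal (β ^ α * (c * β ^ 2) * h ^ (α * H 0)) := by
        rw [setLIntegral_const, ← ENNReal.ofReal_toReal hRtop.ne, ← ENNReal.ofReal_mul' ENNReal.toReal_nonneg]
        congr 1
        simp only [Measure.real]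
        ring
    _ ≤ ∫⁻ η in R, _ := setLIntegral_mono' hRm hinner
    _ ≤ _ := setLIntegral_le_lintegral R _

theorem exists_le_lintegral_kernel {m : ℕ} [NeZero m] {d : Fin m → ℕ} (hd : ∀ j, 0 < d j)
    {E : ∀ j, Matrix (Fin (d j)) (Fin (d j)) ℝ} (hE : ∀ j, ∀ μ ∈ eigenvals (E j), 0 < μ.re)
    {ψ : ∀ j, EuclideanSpace ℝ (Fin (d j)) → ℝ} (hψc : ∀ j, Continuous (ψ j))
    (hψh : ∀ j, IsHomogeneous (E j)ᵀ (ψ j)) (hψnonneg : ∀ j x, 0 ≤ ψ j x)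
    (hψne : ∀ j x, x ≠ 0 → ψ j x ≠ 0) {α : ℝ} (hα0 : 0 < α) (hα2 : α ≤ 2)
    {H : Fin m → ℝ} (hH0 : ∀ j, 0 < H j)
    {τ : EuclideanSpace ℝ (Fin (d 0)) → ℝ} (hτ : IsRadialPart (E 0) τ) :
    ∃ c > 0, ∀ x y : Space d, (∀ j k, x j k ∈ Set.Ico (1 / 2 : ℝ) 1) →
      (∀ j k, y j k ∈ Set.Ico (1 / 2 : ℝ) 1) →
      ENNReal.ofReal (c * τ (x 0 - y 0) ^ (α * H 0)) ≤
        ∫⁻ ξ, ‖kernel α E ψ H x ξ - kernel α E ψ H y ξ‖ₑ ^ α := by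
  obtain ⟨n, rfl⟩ := Nat.exists_eq_succ_of_ne_zero (NeZero.ne m)
  exact exists_le_lintegral_kernel_succ hd hE hψc hψh hψnonneg hψne hα0 hα2 hH0 hτ

/-! ### Simple integrals against a stable random measure -/

section StableMeasure

variable {S Ω : Type*} [MeasureSpace S] [MeasurableSpace Ω]

/-- Countable additivity for a sequence of empty sets makes the partial sums of a constant series
converge, so the constant is `0`. -/
theorem IsIsotropicStableMeasure.empty {α κ : ℝ} {P : Measure Ω} {W : Set S → Ω → ℂ}
    (hW : IsIsotropicStableMeasure α κ P W) : ∀ᵐ ω ∂P, W ∅ ω = 0 := by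
  have h := hW.sigmaAdditive (fun _ => ∅) (fun _ => MeasurableSet.empty)
    (fun i j _ => Set.disjoint_empty _) (by simp)
  filter_upwards [h] with ω hω
  have h1 := (hω.comp (tendsto_add_atTop_nat 1)).sub hω
  simp only [Set.iUnion_empty, Function.comp_def, Finset.sum_range_succ, add_sub_cancel_left,
    sub_self] at h1
  exact tendsto_nhds_unique tendsto_const_nhds h1

theorem IsIsotropicStableMeasure.union {α κ : ℝ} {P : Measure Ω} {W : Set S → Ω → ℂ}
    (hW : IsIsotropicStableMeasure α κ P W) {A B : Set S} (hA : MeasurableSet A)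
    (hB : MeasurableSet B) (hAB : Disjoint A B) (hAf : volume A < ⊤) (hBf : volume B < ⊤) :
    ∀ᵐ ω ∂P, W (A ∪ B) ω = W A ω + W B ω := by
  set U : ℕ → Set S := fun n => if n = 0 then A else if n = 1 then B else ∅ with hU
  have hUm : ∀ i, MeasurableSet (U i) := by
    intro i
    simp only [hU]
    split_ifs <;> simp [hA, hB]
  have hUd : Pairwise (Function.onFun Disjoint U) := by
    intro i j hij
    simp only [hU, Function.onFun]
    split_ifs <;> first | omega | simp [hAB.symm]
  have hUu : ⋃ i, U i = A ∪ B := by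
    ext x
    simp only [Set.mem_iUnion, Set.mem_union, hU]
    constructor
    · rintro ⟨i, hi⟩
      split_ifs at hi <;> simp_all
    · rintro (h | h)
      · exact ⟨0, by simpa using h⟩
      · exact ⟨1, by simpa using h⟩
  have h := hW.sigmaAdditive U hUm hUd (by
    rw [hUu]; exact (measure_union_le _ _).trans_lt (ENNReal.add_lt_top.2 ⟨hAf, hBf⟩))
  filter_upwards [h, hW.empty] with ω hω h0
  rw [hUu] at hω
  refine tendsto_nhds_unique hω (tendsto_const_nhds.congr' ?_)
  filter_upwards [eventually_ge_atTop 2] with n hn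
  obtain ⟨k, rfl⟩ := Nat.exists_eq_add_of_le hn
  have htail : ∑ i ∈ Finset.range k, W (U (2 + i)) ω = 0 :=
    Finset.sum_eq_zero fun i _ => by simp [hU, show 2 + i ≠ 1 by omega, h0]
  rw [Finset.sum_range_add, Finset.sum_range_succ, Finset.sum_range_one, htail]
  simp [hU]

theorem IsIsotropicStableMeasure.biUnion_finset {α κ : ℝ} {P : Measure Ω} {W : Set S → Ω → ℂ}
    (hW : IsIsotropicStableMeasure α κ P W) {ι : Type*} (s : Finset ι) {A : ι → Set S}
    (hA : ∀ i, MeasurableSet (A i)) (hAf : ∀ i ∈ s, volume (A i) < ⊤)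
    (hAd : Pairwise (Function.onFun Disjoint A)) :
    ∀ᵐ ω ∂P, W (⋃ i ∈ s, A i) ω = ∑ i ∈ s, W (A i) ω := by
  classical
  induction s using Finset.induction_on with
  | empty => simpa using hW.empty
  | insert a s ha ih =>
    have h1 := ih fun i hi => hAf i (Finset.mem_insert_of_mem hi)
    have h2 := hW.union (hA a) (Finset.measurableSet_biUnion s fun i _ => hA i)
      (Set.disjoint_iUnion₂_right.2 fun i hi => hAd (by rintro rfl; exact ha hi))
      (hAf a (Finset.mem_insert_self _ _))
      (measure_biUnion_lt_top s.finite_toSet fun i hi => hAf i (Finset.mem_insert_of_mem hi))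
    filter_upwards [h1, h2] with ω h1 h2
    rw [Finset.set_biUnion_insert, h2, h1, Finset.sum_insert ha]

/-- Computes the integral on a finer partition. Applied to the level sets of a pair, it puts two
simple functions on a common partition, which yields additivity. -/
theorem IsIsotropicStableMeasure.simpleIntegral_map {α κ : ℝ} {P : Measure Ω} {W : Set S → Ω → ℂ}
    (hW : IsIsotropicStableMeasure α κ P W) {β : Type*} (p : SimpleFunc S β) (φ : β → ℂ)
    (hp : ∀ c, φ c ≠ 0 → volume (p ⁻¹' {c}) < ⊤) :
    ∀ᵐ ω ∂P, simpleIntegral W (p.map φ) ω = ∑ c ∈ p.range, φ c * W (p ⁻¹' {c}) ω := by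
  classical
  have hz : ∀ z : ℂ, ∀ᵐ ω ∂P, z * W ((p.map φ) ⁻¹' {z}) ω =
      ∑ c ∈ p.range with φ c = z, φ c * W (p ⁻¹' {c}) ω := by
    intro z
    by_cases hz : z = 0
    · refine Eventually.of_forall fun ω => ?_
      rw [hz, zero_mul, Finset.sum_eq_zero]
      intro c hc
      rw [(Finset.mem_filter.1 hc).2, zero_mul]
    · have h := hW.biUnion_finset (p.range.filter fun c => φ c = z) (A := fun c => p ⁻¹' {c})
        (fun c => p.measurableSet_fiber c)
        (fun c hc => hp c (by rw [(Finset.mem_filter.1 hc).2]; exact hz))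
        (fun c c' hcc => (Set.disjoint_singleton.2 hcc).preimage _)
      filter_upwards [h] with ω hω
      have : (p.map φ) ⁻¹' {z} = ⋃ c ∈ p.range.filter fun c => φ c = z, p ⁻¹' {c} := by
        ext x; simp
      rw [this, hω, Finset.mul_sum]
      exact Finset.sum_congr rfl fun c hc => by rw [(Finset.mem_filter.1 hc).2]
  have h := (ae_ball_iff (p.map φ).range.countable_toSet).2 fun z _ => hz z
  filter_upwards [h] with ω hω
  rw [simpleIntegral, Finset.sum_congr rfl fun z hz => hω z hz]
  exact Finset.sum_fiberwise_of_maps_to (fun c hc => by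
    rw [SimpleFunc.range_map]; exact Finset.mem_image_of_mem _ hc) _

theorem IsIsotropicStableMeasure.simpleIntegral_sub {α κ : ℝ} {P : Measure Ω} {W : Set S → Ω → ℂ}
    (hW : IsIsotropicStableMeasure α κ P W) {g g' : SimpleFunc S ℂ} (hg : g.FinMeasSupp volume)
    (hg' : g'.FinMeasSupp volume) :
    ∀ᵐ ω ∂P, simpleIntegral W (g - g') ω = simpleIntegral W g ω - simpleIntegral W g' ω := by
  have hp : ∀ c : ℂ × ℂ, c ≠ 0 → volume ((g.pair g') ⁻¹' {c}) < ⊤ := fun c hc =>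
    (hg.pair hg').meas_preimage_singleton_ne_zero hc
  have h1 := hW.simpleIntegral_map (g.pair g') Prod.fst fun c hc => hp c (by rintro rfl; simp at hc)
  have h2 := hW.simpleIntegral_map (g.pair g') Prod.snd fun c hc => hp c (by rintro rfl; simp at hc)
  have h3 := hW.simpleIntegral_map (g.pair g') (fun c => c.1 - c.2)
    fun c hc => hp c (by rintro rfl; simp at hc)
  filter_upwards [h1, h2, h3] with ω h1 h2 h3
  rw [SimpleFunc.map_fst_pair] at h1
  rw [SimpleFunc.map_snd_pair] at h2
  rw [show g - g' = (g.pair g').map fun c => c.1 - c.2 from rfl, h3, h1, h2, ← Finset.sum_sub_distrib]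
  exact Finset.sum_congr rfl fun c _ => by ring

theorem IsIsotropicStableMeasure.aemeasurable_simpleIntegral {α κ : ℝ} {P : Measure Ω}
    {W : Set S → Ω → ℂ} (hW : IsIsotropicStableMeasure α κ P W) {g : SimpleFunc S ℂ}
    (hg : g.FinMeasSupp volume) : AEMeasurable (simpleIntegral W g) P := by
  unfold simpleIntegral
  refine Finset.aemeasurable_fun_sum _ fun c _ => ?_
  by_cases hc : c = 0
  · simp [hc]
  · exact (hW.aemeasurable _ (g.measurableSet_fiber c)
      (hg.meas_preimage_singleton_ne_zero hc)).const_mul c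

theorem simpleIntegral_eq_sum_filter {S Ω : Type*} [MeasureSpace S]
    (W : Set S → Ω → ℂ) (g : SimpleFunc S ℂ) (ω : Ω) :
    simpleIntegral W g ω = ∑ c ∈ g.range with c ≠ 0, c * W (g ⁻¹' {c}) ω := by
  rw [simpleIntegral, Finset.sum_filter]
  refine Finset.sum_congr rfl fun c _ => ?_
  split_ifs with h
  · rfl
  · rw [not_not.1 h, zero_mul]

theorem toReal_lintegral_enorm_rpow {g : SimpleFunc S ℂ} (hg : g.FinMeasSupp volume) {α : ℝ}
    (hα : 0 < α) : (∫⁻ ξ, ‖g ξ‖ₑ ^ α).toReal =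
      ∑ c ∈ g.range with c ≠ 0, volume.real (g ⁻¹' {c}) * ‖c‖ ^ α := by
  have h1 : ∫⁻ ξ, ‖g ξ‖ₑ ^ α = ∑ c ∈ g.range with c ≠ 0, ‖c‖ₑ ^ α * volume (g ⁻¹' {c}) := by
    have := SimpleFunc.map_lintegral (μ := volume) (fun c : ℂ => ‖c‖ₑ ^ α) g
    rw [← SimpleFunc.lintegral_eq_lintegral] at this
    simp only [SimpleFunc.map_apply] at this
    rw [this, Finset.sum_filter]
    refine Finset.sum_congr rfl fun c _ => ?_
    split_ifs with h
    · rfl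
    · rw [not_not.1 h, enorm_zero, ENNReal.zero_rpow_of_pos hα, zero_mul]
  rw [h1, ENNReal.toReal_sum]
  · refine Finset.sum_congr rfl fun c _ => ?_
    rw [ENNReal.toReal_mul, enorm_rpow_eq_ofReal _ hα.le, ENNReal.toReal_ofReal (by positivity), mul_comm,
      Measure.real]
  · intro c hc
    refine ENNReal.mul_ne_top ?_ (hg.meas_preimage_singleton_ne_zero (Finset.mem_filter.1 hc).2).ne
    exact ENNReal.rpow_ne_top_of_nonneg hα.le enorm_ne_top

/-- The nonzero level sets are disjoint, so the characteristic function factors by independence and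
the exponents add up to the `L^α` integral. -/
theorem IsIsotropicStableMeasure.integral_cexp_simpleIntegral {α κ : ℝ} {P : Measure Ω}
    {W : Set S → Ω → ℂ} (hW : IsIsotropicStableMeasure α κ P W) {g : SimpleFunc S ℂ}
    (hg : g.FinMeasSupp volume) (hα : 0 < α) (t : ℝ) :
    ∫ ω, Complex.exp ((t * (simpleIntegral W g ω).re : ℝ) * Complex.I) ∂P =
      Complex.exp (-(κ * (∫⁻ ξ, ‖g ξ‖ₑ ^ α).toReal * |t| ^ α : ℝ)) := by
  set s := g.range.filter fun c => c ≠ 0 with hs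
  set e := s.equivFin.symm with he
  set A : Fin s.card → Set S := fun i => g ⁻¹' {(e i : ℂ)} with hA
  have hne (i) : (e i : ℂ) ≠ 0 := (Finset.mem_filter.1 (e i).2).2
  have hAm (i) : MeasurableSet (A i) := g.measurableSet_fiber _
  have hAf (i) : volume (A i) < ⊤ := hg.meas_preimage_singleton_ne_zero (hne i)
  have hAd : Pairwise (Function.onFun Disjoint A) := fun i j hij =>
    (Set.disjoint_singleton.2 fun h => hij (e.injective (Subtype.ext h))).preimage _
  have hsum {M : Type} [AddCommMonoid M] (f : ℂ → M) : ∑ c ∈ s, f c = ∑ i, f (e i) := by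
    rw [← Finset.sum_coe_sort, ← Equiv.sum_comp e]
  have hind := hW.indep _ A hAm hAf hAd
  have hprod := hind.integral_fun_prod_comp (𝕜 := ℂ)
    -- `t Re(c W)` is the real inner product of `W` with the conjugate of `tc`.
    (f := fun i w => Complex.exp ((inner ℝ w ((starRingEnd ℂ) (t * (e i : ℂ))) : ℝ) * Complex.I))
    (fun i => hW.aemeasurable _ (hAm i) (hAf i))
    (fun i => Continuous.aestronglyMeasurable (by fun_prop))
  have hfac (i) : ∫ ω, Complex.exp ((inner ℝ (W (A i) ω) ((starRingEnd ℂ) (t * (e i : ℂ))) : ℝ) *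
      Complex.I) ∂P = Complex.exp (-(κ * volume.real (A i) * (|t| * ‖(e i : ℂ)‖) ^ α : ℝ)) := by
    have := hW.charFun_eq _ (hAm i) (hAf i) ((starRingEnd ℂ) (t * (e i : ℂ)))
    rw [charFun_apply, integral_map (hW.aemeasurable _ (hAm i) (hAf i))
      (Continuous.aestronglyMeasurable (by fun_prop))] at this
    rw [this, RCLike.norm_conj, norm_mul, Complex.norm_real, Real.norm_eq_abs]
  calc _ = ∫ ω, ∏ i, Complex.exp ((inner ℝ (W (A i) ω) ((starRingEnd ℂ) (t * (e i : ℂ))) : ℝ) *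
        Complex.I) ∂P := by
        refine integral_congr_ae (Eventually.of_forall fun ω => ?_)
        simp only
        rw [← Complex.exp_sum, simpleIntegral_eq_sum_filter, ← hs, hsum, Complex.re_sum,
          Finset.mul_sum, Complex.ofReal_sum, Finset.sum_mul]
        congr 1
        refine Finset.sum_congr rfl fun i _ => ?_
        congr 2
        simp only [Complex.inner, Complex.mul_re, Complex.mul_im, Complex.conj_re, Complex.conj_im,
          Complex.ofReal_re, Complex.ofReal_im, hA]
        ring
    _ = _ := by
        rw [hprod, Finset.prod_congr rfl fun i _ => hfac i, ← Complex.exp_sum, ← Complex.ofReal_neg]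
        congr 1
        simp only [← Complex.ofReal_neg]
        rw [← Complex.ofReal_sum, toReal_lintegral_enorm_rpow hg hα, ← hs, hsum, Finset.mul_sum,
          Finset.sum_mul, Finset.sum_neg_distrib]
        congr 2
        refine Finset.sum_congr rfl fun i _ => ?_
        rw [Real.mul_rpow (abs_nonneg _) (norm_nonneg _)]
        ring

end StableMeasure

/-! ### Convergence in `L^α` for all `α > 0` -/

/-- The exponent `1 / max 1 α` treats both regimes at once: Minkowski for `α ≥ 1`, subadditivity of
`r ↦ r^α` for `α ≤ 1`. -/
theorem lintegral_add_rpow_rpow_le {S : Type*} [MeasurableSpace S] {μ : Measure S} {α : ℝ}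
    (hα : 0 < α) {u v : S → ENNReal} (hu : AEMeasurable u μ) (hv : AEMeasurable v μ) :
    (∫⁻ a, (u a + v a) ^ α ∂μ) ^ (1 / max 1 α) ≤
      (∫⁻ a, u a ^ α ∂μ) ^ (1 / max 1 α) + (∫⁻ a, v a ^ α ∂μ) ^ (1 / max 1 α) := by
  rcases le_total α 1 with h | h
  · simp only [max_eq_left h, div_one, ENNReal.rpow_one]
    rw [← lintegral_add_left' (hu.pow_const α)]
    exact lintegral_mono fun a => ENNReal.rpow_add_le_add_rpow _ _ hα.le h
  · rw [max_eq_right h]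
    exact ENNReal.lintegral_Lp_add_le hu hv h

section Limits

variable {S : Type*} [MeasurableSpace S] {μ : Measure S} {F : Type*} [NormedAddCommGroup F]
  [MeasurableSpace F] [BorelSpace F] [SecondCountableTopology F] {α : ℝ}

theorem lintegral_enorm_rpow_rpow_le_add (hα : 0 < α) {f g : S → F} (hf : AEMeasurable f μ)
    (hg : AEMeasurable g μ) :
    (∫⁻ a, ‖f a‖ₑ ^ α ∂μ) ^ (1 / max 1 α) ≤
      (∫⁻ a, ‖g a‖ₑ ^ α ∂μ) ^ (1 / max 1 α) + (∫⁻ a, ‖g a - f a‖ₑ ^ α ∂μ) ^ (1 / max 1 α) := by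
  refine le_trans ?_ (lintegral_add_rpow_rpow_le hα hg.enorm (hg.sub hf).enorm)
  refine ENNReal.rpow_le_rpow (lintegral_mono fun a => ENNReal.rpow_le_rpow ?_ hα.le) (by positivity)
  have h := enorm_sub_le (a := g a) (b := g a - f a)
  rwa [sub_sub_cancel] at h

theorem lintegral_enorm_rpow_lt_top_of_tendsto (hα : 0 < α) {f : S → F} {g : ℕ → S → F}
    (hf : AEMeasurable f μ) (hg : ∀ n, AEMeasurable (g n) μ)
    (hfin : ∀ n, ∫⁻ a, ‖g n a‖ₑ ^ α ∂μ < ⊤)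
    (h : Tendsto (fun n => ∫⁻ a, ‖g n a - f a‖ₑ ^ α ∂μ) atTop (𝓝 0)) :
    ∫⁻ a, ‖f a‖ₑ ^ α ∂μ < ⊤ := by
  obtain ⟨n, hn⟩ := (h.eventually_lt_const ENNReal.zero_lt_top).exists
  have hp : 0 < 1 / max 1 α := by positivity
  refine (ENNReal.rpow_lt_top_iff_of_pos hp).1
    ((lintegral_enorm_rpow_rpow_le_add hα hf (hg n)).trans_lt (ENNReal.add_lt_top.2 ⟨?_, ?_⟩))
  · exact (ENNReal.rpow_lt_top_iff_of_pos hp).2 (hfin n)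
  · exact (ENNReal.rpow_lt_top_iff_of_pos hp).2 hn

theorem tendsto_lintegral_enorm_rpow (hα : 0 < α) {f : S → F} {g : ℕ → S → F}
    (hf : AEMeasurable f μ) (hg : ∀ n, AEMeasurable (g n) μ) (hfin : ∫⁻ a, ‖f a‖ₑ ^ α ∂μ < ⊤)
    (h : Tendsto (fun n => ∫⁻ a, ‖g n a - f a‖ₑ ^ α ∂μ) atTop (𝓝 0)) :
    Tendsto (fun n => ∫⁻ a, ‖g n a‖ₑ ^ α ∂μ) atTop (𝓝 (∫⁻ a, ‖f a‖ₑ ^ α ∂μ)) := by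
  set p := 1 / max 1 α with hp
  have hp0 : 0 < p := by positivity
  have he : Tendsto (fun n => (∫⁻ a, ‖g n a - f a‖ₑ ^ α ∂μ) ^ p) atTop (𝓝 0) := by
    have := (ENNReal.continuous_rpow_const (y := p)).tendsto 0 |>.comp h
    rwa [ENNReal.zero_rpow_of_pos hp0] at this
  have hN : Tendsto (fun n => (∫⁻ a, ‖g n a‖ₑ ^ α ∂μ) ^ p) atTop (𝓝 ((∫⁻ a, ‖f a‖ₑ ^ α ∂μ) ^ p)) := by
    have hne : (∫⁻ a, ‖f a‖ₑ ^ α ∂μ) ^ p ≠ ⊤ := ENNReal.rpow_ne_top_of_nonneg hp0.le hfin.ne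
    have hlow := ENNReal.Tendsto.sub (tendsto_const_nhds (x := (∫⁻ a, ‖f a‖ₑ ^ α ∂μ) ^ p)
      (f := atTop (α := ℕ))) he (Or.inl hne)
    have hup := (tendsto_const_nhds (x := (∫⁻ a, ‖f a‖ₑ ^ α ∂μ) ^ p) (f := atTop (α := ℕ))).add he
    rw [tsub_zero] at hlow
    rw [add_zero] at hup
    refine tendsto_of_tendsto_of_tendsto_of_le_of_le hlow hup (fun n => ?_) fun n => ?_
    · exact tsub_le_iff_right.2 (lintegral_enorm_rpow_rpow_le_add hα hf (hg n))
    · refine (lintegral_enorm_rpow_rpow_le_add hα (hg n) hf).trans (le_of_eq ?_)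
      simp only [← hp, enorm_sub_rev (f _)]
  have h2 := (ENNReal.continuous_rpow_const (y := p⁻¹)).tendsto _ |>.comp hN
  simpa only [Function.comp_def, ENNReal.rpow_rpow_inv hp0.ne'] using h2

end Limits

theorem tendstoInMeasure_sub {S F : Type*} [MeasurableSpace S] [NormedAddCommGroup F]
    {P : Measure S} {f f' : ℕ → S → F} {g g' : S → F}
    (h : TendstoInMeasure P f atTop g) (h' : TendstoInMeasure P f' atTop g') :
    TendstoInMeasure P (fun n => f n - f' n) atTop (g - g') := by
  rw [tendstoInMeasure_iff_norm] at h h' ⊢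
  intro ε hε
  have h0 := (h (ε / 2) (by positivity)).add (h' (ε / 2) (by positivity))
  rw [add_zero] at h0
  refine tendsto_of_tendsto_of_tendsto_of_le_of_le tendsto_const_nhds h0 (fun _ => zero_le) fun n => ?_
  refine (measure_mono fun x hx => ?_).trans (measure_union_le _ _)
  by_contra hc
  simp only [Set.mem_union, Set.mem_ofPred_eq, not_or, not_le, Pi.sub_apply] at hc hx
  have := norm_sub_le (f n x - g x) (f' n x - g' x)
  rw [sub_sub_sub_comm] at this
  linarith [hc.1, hc.2]

/-! ### Stable integrals and their characteristic functions -/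

section StableIntegral

variable {S Ω : Type*} [MeasureSpace S] [MeasurableSpace Ω] {α κ : ℝ} {P : Measure Ω}
    {W : Set S → Ω → ℂ}

theorem IsStableIntegral.sub (hW : IsIsotropicStableMeasure α κ P W) (hα : 0 < α) {f f' : S → ℂ}
    {Z Z' : Ω → ℂ} (h : IsStableIntegral α P W f Z) (h' : IsStableIntegral α P W f' Z') :
    IsStableIntegral α P W (f - f') (Z - Z') := by
  obtain ⟨hf, g, hg, hgf, hgZ⟩ := h
  obtain ⟨hf', g', hg', hgf', hgZ'⟩ := h'
  refine ⟨hf.sub hf', fun n => g n - g' n, fun n => ?_, ?_, ?_⟩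
  · exact ((hg n).pair (hg' n)).map (g := fun c : ℂ × ℂ => c.1 - c.2) (sub_self 0)
  · set p := 1 / max 1 α with hp
    have hp0 : 0 < p := by positivity
    have hle (n) : (∫⁻ ξ, ‖(g n - g' n) ξ - (f - f') ξ‖ₑ ^ α) ^ p ≤
        (∫⁻ ξ, ‖g n ξ - f ξ‖ₑ ^ α) ^ p + (∫⁻ ξ, ‖g' n ξ - f' ξ‖ₑ ^ α) ^ p := by
      refine le_trans ?_ (lintegral_add_rpow_rpow_le hα
        ((g n).measurable.aemeasurable.sub hf).enorm ((g' n).measurable.aemeasurable.sub hf').enorm)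
      refine ENNReal.rpow_le_rpow (lintegral_mono fun a => ENNReal.rpow_le_rpow ?_ hα.le) hp0.le
      rw [SimpleFunc.coe_sub, Pi.sub_apply, Pi.sub_apply, sub_sub_sub_comm]
      exact enorm_sub_le
    have h1 := ((ENNReal.continuous_rpow_const (y := p)).tendsto 0 |>.comp hgf).add
      ((ENNReal.continuous_rpow_const (y := p)).tendsto 0 |>.comp hgf')
    rw [ENNReal.zero_rpow_of_pos hp0, add_zero] at h1
    have h2 := tendsto_of_tendsto_of_tendsto_of_le_of_le tendsto_const_nhds h1
      (fun _ => zero_le) hle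
    have h3 := (ENNReal.continuous_rpow_const (y := p⁻¹)).tendsto _ |>.comp h2
    simpa only [Function.comp_def, ENNReal.rpow_rpow_inv hp0.ne',
      ENNReal.zero_rpow_of_pos (inv_pos.2 hp0)] using h3
  · refine (tendstoInMeasure_sub hgZ hgZ').congr_left fun n => ?_
    filter_upwards [hW.simpleIntegral_sub (hg n) (hg' n)] with ω hω
    rw [hω, Pi.sub_apply]

theorem IsStableIntegral.aemeasurable (hW : IsIsotropicStableMeasure α κ P W) {f : S → ℂ}
    {Z : Ω → ℂ} (h : IsStableIntegral α P W f Z) : AEMeasurable Z P := by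
  obtain ⟨-, g, hg, -, hgZ⟩ := h
  exact hgZ.aemeasurable fun n => hW.aemeasurable_simpleIntegral (hg n)

theorem lintegral_enorm_rpow_lt_top_of_finMeasSupp {g : SimpleFunc S ℂ} (hg : g.FinMeasSupp volume)
    (hα : 0 < α) : ∫⁻ ξ, ‖g ξ‖ₑ ^ α < ⊤ := by
  have h := (hg.map (g := fun c : ℂ => ‖c‖ₑ ^ α)
    (by simp [ENNReal.zero_rpow_of_pos hα])).lintegral_lt_top
    (Eventually.of_forall fun ξ => ENNReal.rpow_ne_top_of_nonneg hα.le enorm_ne_top)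
  rwa [← SimpleFunc.lintegral_eq_lintegral] at h

theorem IsStableIntegral.lintegral_lt_top (hα : 0 < α) {f : S → ℂ}
    {Z : Ω → ℂ} (h : IsStableIntegral α P W f Z) : ∫⁻ ξ, ‖f ξ‖ₑ ^ α < ⊤ := by
  obtain ⟨hf, g, hg, hgf, -⟩ := h
  exact lintegral_enorm_rpow_lt_top_of_tendsto hα hf (fun n => (g n).measurable.aemeasurable)
    (fun n => lintegral_enorm_rpow_lt_top_of_finMeasSupp (hg n) hα) hgf

/-- Passes to the limit from simple functions: dominated convergence along an almost surely
convergent subsequence on one side, convergence of the `L^α` integrals on the other. -/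
theorem IsStableIntegral.integral_cexp (hW : IsIsotropicStableMeasure α κ P W)
    [IsProbabilityMeasure P] (hα : 0 < α) {f : S → ℂ}
    {Z : Ω → ℂ} (h : IsStableIntegral α P W f Z) (t : ℝ) :
    ∫ ω, Complex.exp ((t * (Z ω).re : ℝ) * Complex.I) ∂P =
      Complex.exp (-(κ * (∫⁻ ξ, ‖f ξ‖ₑ ^ α).toReal * |t| ^ α : ℝ)) := by
  have hfin := h.lintegral_lt_top hα
  obtain ⟨hf, g, hg, hgf, hgZ⟩ := h
  have h1 := tendsto_lintegral_enorm_rpow hα hf (fun n => (g n).measurable.aemeasurable) hfin hgf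
  have h2 := (ENNReal.tendsto_toReal hfin.ne).comp h1
  obtain ⟨ns, hns, hae⟩ := hgZ.exists_seq_tendsto_ae
  have hlim1 : Tendsto (fun n => ∫ ω, Complex.exp ((t * (simpleIntegral W (g (ns n)) ω).re : ℝ) *
      Complex.I) ∂P) atTop (𝓝 (∫ ω, Complex.exp ((t * (Z ω).re : ℝ) * Complex.I) ∂P)) := by
    have hc : Continuous fun w : ℂ => Complex.exp ((t * w.re : ℝ) * Complex.I) := by fun_prop
    refine tendsto_integral_of_dominated_convergence (fun _ => 1) (fun n => ?_)
      (integrable_const _) (fun n => Eventually.of_forall fun ω => ?_) ?_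
    · exact (hc.measurable.comp_aemeasurable
        (hW.aemeasurable_simpleIntegral (hg (ns n)))).aestronglyMeasurable
    · rw [Complex.norm_exp_ofReal_mul_I]
    · filter_upwards [hae] with ω hω
      exact (hc.tendsto _).comp hω
  have hlim2 : Tendsto (fun n => ∫ ω, Complex.exp ((t * (simpleIntegral W (g (ns n)) ω).re : ℝ) *
      Complex.I) ∂P) atTop (𝓝 (Complex.exp (-(κ * (∫⁻ ξ, ‖f ξ‖ₑ ^ α).toReal * |t| ^ α : ℝ)))) := by
    simp only [hW.integral_cexp_simpleIntegral (hg _) hα]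
    have hc : Continuous fun r : ℝ => Complex.exp (-(κ * r * |t| ^ α : ℝ)) := by fun_prop
    exact (hc.tendsto _).comp (h2.comp hns.tendsto_atTop)
  exact tendsto_nhds_unique hlim1 hlim2

end StableIntegral

/-! ### Scale and moments of the increments -/

theorem IsHarmonizableSheet.hasStableScale {m : ℕ} {d : Fin m → ℕ} {α κ : ℝ}
    {E : ∀ j, Matrix (Fin (d j)) (Fin (d j)) ℝ} {ψ : ∀ j, EuclideanSpace ℝ (Fin (d j)) → ℝ}
    {H : Fin m → ℝ} {Ω : Type*} [MeasurableSpace Ω] {P : Measure Ω} [IsProbabilityMeasure P]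
    {W : Set (Space d) → Ω → ℂ} {X : Space d → Ω → ℝ} (hα : 0 < α) (hκ : 0 < κ)
    (hW : IsIsotropicStableMeasure α κ P W) (hX : IsHarmonizableSheet α E ψ H P W X)
    (x y : Space d) :
    ∫⁻ ξ, ‖kernel α E ψ H x ξ - kernel α E ψ H y ξ‖ₑ ^ α < ⊤ ∧
    HasStableScale α P (fun ω => X x ω - X y ω)
      ((κ * (∫⁻ ξ, ‖kernel α E ψ H x ξ - kernel α E ψ H y ξ‖ₑ ^ α).toReal) ^ (1 / α)) := by
  obtain ⟨Zx, hZx, hXx⟩ := hX x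
  obtain ⟨Zy, hZy, hXy⟩ := hX y
  have hZ := hZx.sub hW hα hZy
  have hXZ : (fun ω => X x ω - X y ω) =ᵐ[P] fun ω => ((Zx - Zy) ω).re := by
    filter_upwards [hXx, hXy] with ω h1 h2
    simp [h1, h2]
  have hm : AEMeasurable (fun ω => X x ω - X y ω) P :=
    (Complex.measurable_re.comp_aemeasurable (hZ.aemeasurable hW)).congr hXZ.symm
  have hI := hZ.lintegral_lt_top hα
  refine ⟨hI, hm, by positivity, fun t => ?_⟩
  rw [← Real.rpow_mul (by positivity), one_div_mul_cancel hα.ne', Real.rpow_one]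
  rw [charFun_apply_real, integral_map hm (Continuous.aestronglyMeasurable (by fun_prop))]
  refine Eq.trans (integral_congr_ae ?_) (hZ.integral_cexp hW hα t)
  filter_upwards [hXZ] with ω hω
  rw [hω]
  push_cast
  rfl

theorem integral_cos_eq_re {Ω : Type*} [MeasurableSpace Ω] {P : Measure Ω} [IsFiniteMeasure P]
    {Y : Ω → ℝ} (hY : AEMeasurable Y P) :
    ∫ ω, Real.cos (Y ω) ∂P = (∫ ω, Complex.exp ((Y ω : ℂ) * Complex.I) ∂P).re := by
  have hc : Continuous fun r : ℝ => Complex.exp ((r : ℂ) * Complex.I) := by fun_prop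
  have hint : Integrable (fun ω => Complex.exp ((Y ω : ℂ) * Complex.I)) P :=
    Integrable.of_bound (hc.measurable.comp_aemeasurable hY).aestronglyMeasurable 1
      (Eventually.of_forall fun ω => (Complex.norm_exp_ofReal_mul_I _).le)
  have h := integral_re hint
  simp only [RCLike.re_eq_complex_re, Complex.exp_ofReal_mul_I_re] at h
  exact h

theorem one_sub_cos_le_two_mul_rpow {α : ℝ} (hα0 : 0 < α) (hα2 : α ≤ 2) (r : ℝ) :
    1 - Real.cos r ≤ 2 * |r| ^ α := by
  rcases le_total |r| 1 with hr | hr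
  · have h3 : |r| ^ (2 : ℝ) ≤ |r| ^ α := by
      rcases (abs_nonneg r).eq_or_lt with h0 | h0
      · rw [← h0, Real.zero_rpow hα0.ne', Real.zero_rpow two_ne_zero]
      · exact Real.rpow_le_rpow_of_exponent_ge h0 hr hα2
    rw [Real.rpow_two, sq_abs] at h3
    linarith [Real.one_sub_sq_div_two_le_cos (x := r), sq_nonneg r]
  · linarith [Real.neg_one_le_cos r, Real.one_le_rpow hr hα0.le]

/-- The `α`-th moment of an `α`-stable variable dominates its scale parameter. -/
theorem HasStableScale.le_lintegral {α : ℝ} (hα0 : 0 < α) (hα2 : α ≤ 2) {Ω : Type*}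
    [MeasurableSpace Ω] {P : Measure Ω} [IsProbabilityMeasure P] {Z : Ω → ℝ} {σ : ℝ}
    (h : HasStableScale α P Z σ) :
    ENNReal.ofReal ((1 - Real.exp (-1)) / 2 * σ ^ α) ≤ ∫⁻ ω, ‖Z ω‖ₑ ^ α ∂P := by
  obtain ⟨hm, hσ, hchar⟩ := h
  rcases hσ.eq_or_lt with rfl | hσ0
  · simp [Real.zero_rpow hα0.ne']
  -- At `t = 1/σ` the characteristic function is `e^{-1}`, so `1 - cos(Z/σ)` has mean `1 - e^{-1}`,
  -- while it is at most `2 |Z/σ|^α`.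
  have h1 := hchar σ⁻¹
  rw [abs_of_pos (inv_pos.2 hσ0), ← Real.mul_rpow hσ (inv_pos.2 hσ0).le, mul_inv_cancel₀ hσ0.ne',
    Real.one_rpow, charFun_apply_real, integral_map hm (Continuous.aestronglyMeasurable (by fun_prop))] at h1
  simp only [← Complex.ofReal_mul] at h1
  have hYm : AEMeasurable (fun ω => σ⁻¹ * Z ω) P := hm.const_mul _
  have hcos : ∫ ω, Real.cos (σ⁻¹ * Z ω) ∂P = Real.exp (-1) := by
    rw [integral_cos_eq_re hYm, h1, ← Complex.ofReal_neg, ← Complex.ofReal_exp, Complex.ofReal_re]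
  have hcosint : Integrable (fun ω => Real.cos (σ⁻¹ * Z ω)) P :=
    Integrable.of_bound (Real.continuous_cos.measurable.comp_aemeasurable hYm).aestronglyMeasurable 1
      (Eventually.of_forall fun ω => Real.abs_cos_le_one _)
  have hcint : Integrable (fun ω => 1 - Real.cos (σ⁻¹ * Z ω)) P := (integrable_const 1).sub hcosint
  have hI : ∫ ω, (1 - Real.cos (σ⁻¹ * Z ω)) ∂P = 1 - Real.exp (-1) := by
    rw [integral_sub (integrable_const 1) hcosint, hcos]
    simp
  have h4 : ENNReal.ofReal (1 - Real.exp (-1)) ≤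
      ENNReal.ofReal (2 * σ⁻¹ ^ α) * ∫⁻ ω, ‖Z ω‖ₑ ^ α ∂P := by
    rw [← hI, ofReal_integral_eq_lintegral_ofReal hcint
      (Eventually.of_forall fun ω => sub_nonneg.2 (Real.cos_le_one _)),
      ← lintegral_const_mul' _ _ ENNReal.ofReal_ne_top]
    refine lintegral_mono fun ω => ?_
    rw [enorm_rpow_eq_ofReal _ hα0.le, ← ENNReal.ofReal_mul (by positivity)]
    refine ENNReal.ofReal_le_ofReal ((one_sub_cos_le_two_mul_rpow hα0 hα2 _).trans (le_of_eq ?_))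
    rw [abs_mul, abs_of_pos (inv_pos.2 hσ0), Real.mul_rpow (by positivity) (abs_nonneg _),
      Real.norm_eq_abs, mul_assoc]
  have hσα : 0 < σ ^ α := Real.rpow_pos_of_pos hσ0 _
  calc ENNReal.ofReal ((1 - Real.exp (-1)) / 2 * σ ^ α)
      = ENNReal.ofReal (σ ^ α / 2) * ENNReal.ofReal (1 - Real.exp (-1)) := by
        rw [← ENNReal.ofReal_mul (by positivity)]; congr 1; ring
    _ ≤ ENNReal.ofReal (σ ^ α / 2) * (ENNReal.ofReal (2 * σ⁻¹ ^ α) * ∫⁻ ω, ‖Z ω‖ₑ ^ α ∂P) :=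
        mul_le_mul' le_rfl h4
    _ = _ := by
        rw [← mul_assoc, ← ENNReal.ofReal_mul (by positivity), Real.inv_rpow hσ]
        rw [show σ ^ α / 2 * (2 * (σ ^ α)⁻¹) = 1 by field_simp, ENNReal.ofReal_one, one_mul]

end StableSheet

end

theorem theorem4p4 {m : ℕ} [NeZero m] (d : Fin m → ℕ) (hd : ∀ j, 0 < d j)
    (E : ∀ j, Matrix (Fin (d j)) (Fin (d j)) ℝ)
    (hE : ∀ j, ∀ μ ∈ StableSheet.eigenvals (E j), 0 < μ.re)
    (ψ : ∀ j, EuclideanSpace ℝ (Fin (d j)) → ℝ)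
    (hψc : ∀ j, Continuous (ψ j))
    (hψh : ∀ j, StableSheet.IsHomogeneous (E j)ᵀ (ψ j))
    (hψnonneg : ∀ j x, 0 ≤ ψ j x)
    (hψne : ∀ j x, x ≠ 0 → ψ j x ≠ 0)
    (α : ℝ) (hα0 : 0 < α) (hα2 : α ≤ 2) (κ : ℝ) (hκ : 0 < κ)
    (H : Fin m → ℝ) (hH0 : ∀ j, 0 < H j)
    (hH : ∀ j, ∀ μ ∈ StableSheet.eigenvals (E j), H j < μ.re)
    (τ : EuclideanSpace ℝ (Fin (d 0)) → ℝ) (hτ : StableSheet.IsRadialPart (E 0) τ) :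
    ∃ C : ℝ, 0 < C ∧
      ∀ (Ω : Type*) [MeasurableSpace Ω] (P : Measure Ω) [IsProbabilityMeasure P]
        (W : Set (StableSheet.Space d) → Ω → ℂ) (X : StableSheet.Space d → Ω → ℝ),
        StableSheet.IsIsotropicStableMeasure α κ P W →
        StableSheet.IsHarmonizableSheet α E ψ H P W X →
        ∀ x y : StableSheet.Space d,
          (∀ j k, x j k ∈ Set.Ico (1 / 2 : ℝ) 1) → (∀ j k, y j k ∈ Set.Ico (1 / 2 : ℝ) 1) →
          (∃ σ : ℝ, StableSheet.HasStableScale α P (fun ω => X x ω - X y ω) σ ∧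
            C * τ (x 0 - y 0) ^ H 0 ≤ σ) ∧
          ENNReal.ofReal (C * τ (x 0 - y 0) ^ H 0) ≤
            eLpNorm (fun ω => X x ω - X y ω) (ENNReal.ofReal α) P := by
  obtain ⟨c, hc, hker⟩ := StableSheet.exists_le_lintegral_kernel hd hE hψc hψh hψnonneg hψne
    hα0 hα2 hH0 hτ
  have he : Real.exp (-1) < 1 := Real.exp_lt_one_iff.2 (by norm_num)
  have he0 : 0 < Real.exp (-1) := Real.exp_pos _
  set b := (1 - Real.exp (-1)) / 2 with hb
  have hb0 : 0 < b := by rw [hb]; linarith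
  have hb1 : b ≤ 1 := by rw [hb]; linarith
  -- The factor `b^{1/α}` is the loss in comparing the moment with the scale; as `b ≤ 1`, the same
  -- constant serves for the scale itself.
  refine ⟨b ^ (1 / α) * (κ * c) ^ (1 / α), by positivity, fun Ω _ P _ W X hW hX x y hx hy => ?_⟩
  obtain ⟨hfin, hscale⟩ := hX.hasStableScale hα0 hκ hW x y
  set I := ∫⁻ ξ, ‖StableSheet.kernel α E ψ H x ξ - StableSheet.kernel α E ψ H y ξ‖ₑ ^ α with hI
  have hτ0 : 0 ≤ τ (x 0 - y 0) := by
    by_cases h0 : x 0 - y 0 = 0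
    · simp [h0, hτ.zero]
    · exact (hτ.pos _ h0).le
  have hlow : (κ * c) ^ (1 / α) * τ (x 0 - y 0) ^ H 0 ≤ (κ * I.toReal) ^ (1 / α) := by
    have h1 : c * τ (x 0 - y 0) ^ (α * H 0) ≤ I.toReal :=
      (ENNReal.ofReal_le_iff_le_toReal hfin.ne).1 (hker x y hx hy)
    have h2 : τ (x 0 - y 0) ^ H 0 = (τ (x 0 - y 0) ^ (α * H 0)) ^ (1 / α) := by
      rw [← Real.rpow_mul hτ0]; congr 1; field_simp
    rw [h2, ← Real.mul_rpow (by positivity) (by positivity), mul_assoc]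
    gcongr
  set σ := (κ * I.toReal) ^ (1 / α) with hσ
  have hσ0 : 0 ≤ σ := hscale.2.1
  have hbσ : b ^ (1 / α) * (κ * c) ^ (1 / α) * τ (x 0 - y 0) ^ H 0 ≤ b ^ (1 / α) * σ := by
    rw [mul_assoc]; gcongr
  refine ⟨⟨σ, hscale, hbσ.trans (mul_le_of_le_one_left hσ0
    (Real.rpow_le_one hb0.le hb1 (by positivity)))⟩, (ENNReal.ofReal_le_ofReal hbσ).trans ?_⟩
  rw [eLpNorm_eq_lintegral_rpow_enorm_toReal (by simpa using hα0) ENNReal.ofReal_ne_top,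
    ENNReal.toReal_ofReal hα0.le]
  have h3 := ENNReal.rpow_le_rpow (hscale.le_lintegral hα0 hα2) (z := 1 / α) (by positivity)
  refine le_trans (le_of_eq ?_) h3
  rw [ENNReal.ofReal_rpow_of_nonneg (by positivity) (by positivity),
    Real.mul_rpow hb0.le (by positivity), ← Real.rpow_mul hσ0, mul_one_div_cancel hα0.ne',
    Real.rpow_one]
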